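/- **Setting.** Consider the robust problem $$\min_{x\in X}\ c^\top x\quad\text{s.t.}\quad f_i(x):=\max_{z\in Z^i} g_i(x,z)\le 0\ (i\in[m]),\qquad Ax=b, \tag{P}$$ where $X\subseteq\mathbb R^n$ is closed and convex, $A\in\mathbb R^{r\times n}$, $g_i(x,z)=x^\top Q_iz+d_i^\top x+q_i^\top z+\gamma_i$ is biaffine, and $Z^i=\bigcap_{l=1}^{s_i}Z^{i,l}$ ($s_i\ge1$) with $Z^{i,l}$ compact convex. All norms are Euclidean (induced norms for matrices). Let $L(x,(\lambda,w))=c^\top x+\sum_i\lambda_if_i(x)+w^\top(Ax-b)$. Assume: (1) (P) has an optimal solution; (2) there are $\hat x\in\operatorname{int}X$ and $\epsilon_{\hat x}>0$ with $A\hat x=b$ and, for all $\|v\|\le\epsilon_{\hat x}$, $\hat x+v\in X$ and $f_i(\hat x+v)<0$ for all $i$; (3) $A$ has full row rank; (4) $B(0,\epsilon_i)\subseteq Z^i$ with $\epsilon_i>0$; (5) $-g_i(x,0)\le\bar\mu_i$ for all feasible $x$, with $\bar\mu_i>0$. Let $\underline v$ be a strict lower bound on the optimal value of (P). Let $U^{i,l}=\{(\tilde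 z,\lambda):\lambda\ge0,\ \tilde z\in\lambda Z^{i,l}\}$, $\tilde Q_i=[Q_i\ d_i]$, $\tilde q_i=(q_i,\gamma_i)$, $\chi=(x,\omega)$ with $\omega=(\omega_{i,l})_{i\in[m],\,l\in[s_i-1]}$, $y=(\tilde u,w,\pi)$ with $\tilde u=(u_{i,l})_{i\in[m],\,l\in[s_i]}$ (where $\omega_{i,l},u_{i,l}\in\mathbb R^{d_i+1}$, $d_i$ here denoting the dimension of $z_i$), and, with $\sigma_X$ the support function of $X$ and $\delta$ the $\{0,+\infty\}$-valued indicator, $$\check L(\chi,y)=x^\top\Big(c+\sum_i\tilde Q_iu_{i,s_i}+A^\top w+\pi\Big)+\sum_i\Big(\tilde q_i^\top u_{i,s_i}+\sum_{l<s_i}\omega_{i,l}^\top(u_{i,l}-u_{i,s_i})-\sum_{l\le s_i}\delta_{U^{i,l}}(u_{i,l})\Big)-b^\top w-\sigma_X(\pi).$$ Let $\bar Q$ be the linear map sending $y$ to the vector with $x$-block $\sum_i\tilde Q_iu_{i,s_i}+A^\top w+\pi$ and $\omega_{i,l}$-blocks $u_{i,l}-u_{i,s_i}$. PAPC with step sizes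 $\tau,\theta_1,\dots,\theta_m,\theta_w,\theta_\pi>0$ starts from $(\chi^0,y^0)$ with $u^0_{i,l}\in U^{i,l}$ (the other components being arbitrary) and iterates, for $k\ge1$: * predictor: $p_x=x^{k-1}-\tau(c+\sum_i\tilde Q_iu^{k-1}_{i,s_i}+A^\top w^{k-1}+\pi^{k-1})$, $\ p_{\omega_{i,l}}=\omega_{i,l}^{k-1}-\tau(u^{k-1}_{i,l}-u^{k-1}_{i,s_i})$; * dual update: $u_{i,l}^k=P_{U^{i,l}}(u_{i,l}^{k-1}+\theta_ip_{\omega_{i,l}})$ for $l<s_i$, $\ u_{i,s_i}^k=P_{U^{i,s_i}}\big(u_{i,s_i}^{k-1}+\theta_i(\tilde Q_i^\top p_x+\tilde q_i-\sum_{l<s_i}p_{\omega_{i,l}})\big)$, $\ w^k=w^{k-1}+\theta_w(Ap_x-b)$, $\ \pi^k=\operatorname{prox}_{\theta_\pi\sigma_X}(\pi^{k-1}+\theta_\pi p_x)$; * corrector: $x^k=x^{k-1}-\tau(c+\sum_i\tilde Q_iu^{k}_{i,s_i}+A^\top w^{k}+\pi^{k})$, $\ \omega_{i,l}^k=\omega_{i,l}^{k-1}-\tau(u^{k}_{i,l}-u^{k}_{i,s_i})$.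 Bars with superscript $N\ge1$ denote averages over $k=1,\dots,N$. Let $S=\operatorname{Diag}(\theta_1^{-1}I,\dots,\theta_m^{-1}I,\theta_w^{-1}I,\theta_\pi^{-1}I)$ and assume $H=S-\tau\bar Q^\top\bar Q\succeq0$; write $\|y\|_H^2=y^\top Hy$. **Constants.** Let $R_{i,l}=\max_{z\in Z^{i,l}}\|z\|$, $\sigma_i=\sum_{l\in[s_i]}(1+4R_{i,l}^2)$, $\lambda_i^0=\max_l\lambda_{i,l}^0$ where $u_{i,l}^0=(\tilde z_{i,l}^0,\lambda_{i,l}^0)$, and $$\bar\lambda=\frac{c^\top\hat x-\underline v}{-\max_if_i(\hat x)},\quad R_w=\frac1{\sigma_{\min}(A)}\Big(\frac{c^\top\hat x-\underline v}{\epsilon_{\hat x}}+\|c\|\Big),\quad \beta=R_\pi=\|c\|+\|A\|R_w+\bar\lambda\sum_i\|\tilde Q_i\|(R_{i,s_i}+1),$$ $$\phi=\max\Big\{\frac2{\theta_\pi},\ \frac4\tau\sum_is_i\bar\mu_i^2\Big(1+\frac1{\epsilon_i}\Big)^2+\frac{2\|\pi^0\|^2}{\theta_\pi}\Big\},\qquad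 \Omega^{i,l}=\Big\{(\nu,\mu):-\bar\mu_i\le\mu\le0,\ \|\nu\|\le-\frac{\mu}{\epsilon_i}\Big\}.$$ **Statement.** (a) For every $N\ge1$ and all $\chi,y$, $$\check L(\bar\chi^N,y)-\check L(\chi,\bar y^N)\le\frac{\tau^{-1}\|\chi-\chi^0\|^2+\|y-y^0\|_H^2}{2N}.$$ (b) Let $\omega^0_{i,l}\in\Omega^{i,l}$ for all $i,l$ (for example $\omega^0=0$), let $x^*$ be an optimal solution of (P) and $(\lambda^*,w^*)$ an optimal solution of the dual problem $\sup_{\lambda\ge0,w}\inf_{x\in X}L(x,(\lambda,w))$. Then for all $N\ge1$, $\alpha\ge0$, $\lambda\in\mathbb R^m_+$, $w\in\mathbb R^r$, $$L(\bar x^N,(\lambda,w))-L(x^*,(\lambda^*,w^*))+\alpha\operatorname{dist}(\bar x^N,X)\le\frac1{2N}\Big(\frac{\|x^*-x^0\|^2}\tau+2\sum_i\frac{\sigma_i}{\theta_i}\max\{\lambda_i,\lambda_i^0\}^2+\frac{4\max\{\|w\|,\|w^0\|\}^2}{\theta_w}+\phi(1+\alpha^2)\Big)$$ and $L(\bar x^N,(\lambda^*,w^*))+\beta\operatorname{dist}(\bar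 x^N,X)\ge c^\top x^*$. (c) Call an iterative method producing sequences $(x^k,\lambda^k,w^k)$ $\psi$-ergodically bounded (EB), where $\psi(N)\ge0$ decreases to $0$ as $N\to\infty$, with constants $\phi,\beta\ge0$ and $\tau,\vartheta_i,\vartheta_w>0$, if it can be started from every $x^0\in\mathbb R^n$, $\lambda^0\in\mathbb R^m_+$, $w^0\in\mathbb R^r$ and, for every sequence it produces, every saddle point $(x^*,(\lambda^*,w^*))$ of $L$ over $X\times(\mathbb R^m_+\times\mathbb R^r)$ and all $N\ge1$, $\alpha\ge0$, $\lambda\in\mathbb R^m_+$, $w\in\mathbb R^r$, one has $L(\bar x^N,(\lambda,w))-L(x^*,(\lambda^*,w^*))+\alpha\operatorname{dist}(\bar x^N,X)\le\psi(N)\big(\tau^{-1}\|x^*-x^0\|^2+\sum_i\vartheta_i^{-1}\max\{\lambda_i,\lambda_i^0\}^2+\vartheta_w^{-1}\max\{\|w\|,\|w^0\|\}^2+\phi(1+\alpha^2)\big)$ and $L(\bar x^N,(\lambda^*,w^*))-L(x^*,(\lambda^*,w^*))+\beta\operatorname{dist}(\bar x^N,X)\ge0$. For every $\pi^0$, PAPC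 started with this $\pi^0$, with $\omega^0_{i,l}\in\Omega^{i,l}$ and with $\lambda^0_{i,l}=\lambda_i^0$ for all $l$ (and $\lambda_i^k:=\lambda_{i,s_i}^k$) is $\psi$-EB with $\psi(N)=1/(2N)$, the above $\tau,\phi,\beta$, $\vartheta_i=\theta_i/(2\sigma_i)$ and $\vartheta_w=\theta_w/4$. (d) Consequently, for $\omega^0$ as in (b), every optimal $x^*$ and every $N\ge1$, $$\sum_i[f_i(\bar x^N)]_++\|A\bar x^N-b\|+\operatorname{dist}(\bar x^N,X)\le\frac1{2N}\Big(\frac{\|x^*-x^0\|^2}\tau+2\sum_i\frac{\sigma_i}{\theta_i}\max\{\bar\lambda+1,\lambda_i^0\}^2+\frac{4\max\{R_w+1,\|w^0\|\}^2}{\theta_w}+\phi(1+(1+\beta)^2)\Big),$$ $$|c^\top(\bar x^N-x^*)|\le\frac1{2N}\Big(\frac{\|x^*-x^0\|^2}\tau+2\sum_i\frac{\sigma_i}{\theta_i}\max\{2\bar\lambda,\lambda_i^0\}^2+\frac{4\max\{2R_w,\|w^0\|\}^2}{\theta_w}+\phi(1+4\beta^2)\Big).$$ -/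

import Mathlib

open scoped InnerProductSpace

noncomputable section

namespace RobustPAPC

/-- Euclidean space `ℝ^n`. -/
abbrev Vec (n : ℕ) : Type := EuclideanSpace ℝ (Fin n)

/-- The lifted space `ℝ^(d+1)` of pairs `u = (z̃, λ)`, with the Euclidean norm. -/
abbrev Lift (d : ℕ) : Type := WithLp 2 (Vec d × ℝ)

/-- The pair `(z̃, λ)` as a point of the lifted space. -/
def mkLift {d : ℕ} (z : Vec d) (t : ℝ) : Lift d := WithLp.toLp 2 (z, t)

/-- Support function `σ_C(π) = sup_{x ∈ C} ⟨π, x⟩` of a set, with values in the extended reals. -/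
def supportFn {n : ℕ} (C : Set (Vec n)) (v : Vec n) : EReal :=
  ⨆ x ∈ C, ((⟪v, x⟫_ℝ : ℝ) : EReal)

/-- `p` is the (Euclidean) projection of `v` onto `K`. -/
def IsProjOn {V : Type*} [NormedAddCommGroup V] (K : Set V) (v p : V) : Prop :=
  p ∈ K ∧ ∀ q ∈ K, ‖p - v‖ ≤ ‖q - v‖

/-- `p = prox_{t f}(v)`, that is, `p` minimizes `f(q) + ‖q - v‖² / (2 t)` over all `q`. -/
def IsProxOf {V : Type*} [NormedAddCommGroup V] (t : ℝ) (f : V → EReal) (v p : V) : Prop :=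
  ∀ q, f p + ((‖p - v‖ ^ 2 / (2 * t) : ℝ) : EReal) ≤ f q + ((‖q - v‖ ^ 2 / (2 * t) : ℝ) : EReal)

/-- Ergodic average `(1/N) ∑_{k=1}^N v^k`. -/
def ergodic {V : Type*} [AddCommGroup V] [Module ℝ V] (v : ℕ → V) (N : ℕ) : V :=
  (1 / (N : ℝ)) • ∑ k ∈ Finset.Icc 1 N, v k

/-- Radius `max_{z ∈ C} ‖z‖` of a (compact, nonempty) set. -/
def radius {n : ℕ} (C : Set (Vec n)) : ℝ := sSup ((fun z => ‖z‖) '' C)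

/-- Data of the robust problem
`min ⟨c, x⟩` over `x ∈ X` with `A x = b` and `max_{z ∈ Z^i} g_i(x, z) ≤ 0` for all `i`,
where `g_i(x, z) = ⟨x, Q_i z⟩ + ⟨d_i, x⟩ + ⟨q_i, z⟩ + γ_i` and `Z^i` is the intersection of the
`s_i = k i + 1` sets `Z i l`, `l : Fin (k i + 1)`.  Matrices are given by the linear maps between
Euclidean spaces that they represent; `dim i` is the dimension of the uncertain vector `z_i`. -/
structure Problem (n r m : ℕ) (dim k : Fin m → ℕ) where
  c : Vec n
  X : Set (Vec n)
  A : Vec n →L[ℝ] Vec r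
  b : Vec r
  Q : ∀ i, Vec (dim i) →L[ℝ] Vec n
  dvec : Fin m → Vec n
  q : ∀ i, Vec (dim i)
  gam : Fin m → ℝ
  Z : ∀ i, Fin (k i + 1) → Set (Vec (dim i))
  X_closed : IsClosed X
  X_convex : Convex ℝ X
  Z_compact : ∀ i l, IsCompact (Z i l)
  Z_convex : ∀ i l, Convex ℝ (Z i l)

variable {n r m : ℕ} {dim k : Fin m → ℕ}

/-- Primal variables `χ = (x, ω)` with `ω = (ω_{i,l})`, `l = 1, …, s_i - 1`; Euclidean norm. -/
abbrev Primal (n : ℕ) {m : ℕ} (dim k : Fin m → ℕ) : Type :=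
  WithLp 2 (Vec n × PiLp 2 (fun j : (Σ i : Fin m, Fin (k i)) => Lift (dim j.1)))

/-- Dual variables `y = (ũ, w, π)` with `ũ = (u_{i,l})`, `l = 1, …, s_i`; Euclidean norm. -/
abbrev Dual (n r : ℕ) {m : ℕ} (dim k : Fin m → ℕ) : Type :=
  WithLp 2 (PiLp 2 (fun j : (Σ i : Fin m, Fin (k i + 1)) => Lift (dim j.1)) ×
    WithLp 2 (Vec r × Vec n))

namespace Primal

/-- The component `x`. -/
def x (χ : Primal n dim k) : Vec n := χ.fst

/-- The component `ω_{i,l}`, `l = 1, …, s_i - 1`. -/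
def om (χ : Primal n dim k) (i : Fin m) (l : Fin (k i)) : Lift (dim i) := χ.snd ⟨i, l⟩

/-- The primal vector with given components. -/
def mk (x : Vec n) (om : ∀ i, Fin (k i) → Lift (dim i)) : Primal n dim k :=
  WithLp.toLp 2 (x, WithLp.toLp 2 (fun j => om j.1 j.2))

end Primal

namespace Dual

/-- The component `u_{i,l}`, `l = 1, …, s_i`. -/
def u (y : Dual n r dim k) (i : Fin m) (l : Fin (k i + 1)) : Lift (dim i) := y.fst ⟨i, l⟩

/-- The component `u_{i,s_i}`. -/
def uLast (y : Dual n r dim k) (i : Fin m) : Lift (dim i) := u y i (Fin.last (k i))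

/-- The component `w`. -/
def w (y : Dual n r dim k) : Vec r := y.snd.fst

/-- The component `π`. -/
def pi (y : Dual n r dim k) : Vec n := y.snd.snd

/-- The dual vector with given components. -/
def mk (u : ∀ i, Fin (k i + 1) → Lift (dim i)) (w : Vec r) (p : Vec n) : Dual n r dim k :=
  WithLp.toLp 2 (WithLp.toLp 2 (fun j => u j.1 j.2), WithLp.toLp 2 (w, p))

end Dual

namespace Problem

variable (P : Problem n r m dim k)

/-- `Z^i = ⋂_l Z^{i,l}`. -/
def Zcap (i : Fin m) : Set (Vec (dim i)) := ⋂ l, P.Z i l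

/-- The biaffine constraint function `g_i`. -/
def g (i : Fin m) (x : Vec n) (z : Vec (dim i)) : ℝ :=
  ⟪x, P.Q i z⟫_ℝ + ⟪P.dvec i, x⟫_ℝ + ⟪P.q i, z⟫_ℝ + P.gam i

/-- `f_i(x) = max_{z ∈ Z^i} g_i(x, z)`. -/
def f (i : Fin m) (x : Vec n) : ℝ := sSup ((fun z => P.g i x z) '' P.Zcap i)

/-- Feasible points of the robust problem. -/
def IsFeasible (x : Vec n) : Prop := x ∈ P.X ∧ P.A x = P.b ∧ ∀ i, P.f i x ≤ 0

/-- Optimal solutions of the robust problem. -/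
def IsOptimal (x : Vec n) : Prop :=
  P.IsFeasible x ∧ ∀ x', P.IsFeasible x' → ⟪P.c, x⟫_ℝ ≤ ⟪P.c, x'⟫_ℝ

/-- Slater point `xhat` with margin `e`. -/
def IsSlater (xhat : Vec n) (e : ℝ) : Prop :=
  xhat ∈ interior P.X ∧ P.A xhat = P.b ∧ 0 < e ∧
    ∀ v : Vec n, ‖v‖ ≤ e → xhat + v ∈ P.X ∧ ∀ i, P.f i (xhat + v) < 0

/-- The Lagrangian `L(x, (λ, w))`. -/
def lagrangian (x : Vec n) (lam : Fin m → ℝ) (w : Vec r) : ℝ :=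
  ⟪P.c, x⟫_ℝ + ∑ i, lam i * P.f i x + ⟪w, P.A x - P.b⟫_ℝ

/-- The dual function `(λ, w) ↦ inf_{x ∈ X} L(x, (λ, w))`. -/
def dualFn (lam : Fin m → ℝ) (w : Vec r) : EReal :=
  ⨅ x ∈ P.X, ((P.lagrangian x lam w : ℝ) : EReal)

/-- Optimal solutions `(λ, w)` of the dual problem `sup_{λ ≥ 0, w} inf_{x ∈ X} L(x, (λ, w))`. -/
def IsDualOptimal (lam : Fin m → ℝ) (w : Vec r) : Prop :=
  (∀ i, 0 ≤ lam i) ∧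
    ∀ (lam' : Fin m → ℝ) (w' : Vec r), (∀ i, 0 ≤ lam' i) → P.dualFn lam' w' ≤ P.dualFn lam w

/-- Saddle points of the Lagrangian over `X × (ℝ^m_+ × ℝ^r)`. -/
def IsSaddle (x : Vec n) (lam : Fin m → ℝ) (w : Vec r) : Prop :=
  x ∈ P.X ∧ (∀ i, 0 ≤ lam i) ∧
    (∀ (lam' : Fin m → ℝ) (w' : Vec r), (∀ i, 0 ≤ lam' i) →
      P.lagrangian x lam' w' ≤ P.lagrangian x lam w) ∧
    ∀ x' ∈ P.X, P.lagrangian x lam w ≤ P.lagrangian x' lam w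

/-- The lifted cone `U^{i,l} = {(z̃, λ) : λ ≥ 0, z̃ ∈ λ Z^{i,l}}`. -/
def U (i : Fin m) (l : Fin (k i + 1)) : Set (Lift (dim i)) :=
  {u | 0 ≤ u.snd ∧ ∃ z ∈ P.Z i l, u.fst = u.snd • z}

/-- The block matrix `Q̃_i = [Q_i  d_i]`, `Q̃_i (z̃, λ) = Q_i z̃ + λ d_i`. -/
def Qt (i : Fin m) : Lift (dim i) →L[ℝ] Vec n :=
  (P.Q i) ∘L (WithLp.fstL 2 ℝ (Vec (dim i)) ℝ)
    + (WithLp.sndL 2 ℝ (Vec (dim i)) ℝ).smulRight (P.dvec i)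

/-- `q̃_i = (q_i, γ_i)`. -/
def qt (i : Fin m) : Lift (dim i) := mkLift (P.q i) (P.gam i)

/-- The matrix `Q̄`:  `Q̄ (ũ, w, π)` has `x`-block `∑_i Q̃_i u_{i,s_i} + Aᵀ w + π` and
`ω_{i,l}`-block `u_{i,l} - u_{i,s_i}`. -/
def Qbar : Dual n r dim k →L[ℝ] Primal n dim k :=
  LinearMap.toContinuousLinearMap
    { toFun := fun y => Primal.mk
        (∑ i, P.Qt i (Dual.uLast y i) + P.A.adjoint (Dual.w y) + Dual.pi y)
        (fun i l => Dual.u y i l.castSucc - Dual.uLast y i)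
      map_add' := by
        intro y y'
        refine (WithLp.ext_iff ..).2 (Prod.ext ?_ ((WithLp.ext_iff ..).2 (funext fun j => ?_)))
        · simp only [Primal.mk, Dual.uLast, Dual.u, Dual.w, Dual.pi, WithLp.add_fst,
            WithLp.add_snd, PiLp.add_apply, map_add, Finset.sum_add_distrib, WithLp.ofLp_add,
            Prod.fst_add]
          abel
        · simp only [Primal.mk, Dual.uLast, Dual.u, WithLp.add_fst, PiLp.add_apply,
            WithLp.ofLp_add, Prod.snd_add]
          abel
      map_smul' := by
        intro t y
        refine (WithLp.ext_iff ..).2 (Prod.ext ?_ ((WithLp.ext_iff ..).2 (funext fun j => ?_)))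
        · simp only [Primal.mk, Dual.uLast, Dual.u, Dual.w, Dual.pi, WithLp.smul_fst,
            WithLp.smul_snd, PiLp.smul_apply, map_smul, ← Finset.smul_sum, WithLp.ofLp_smul,
            Prod.smul_fst, RingHom.id_apply, smul_add]
        · simp only [Primal.mk, Dual.uLast, Dual.u, WithLp.smul_fst, PiLp.smul_apply,
            WithLp.ofLp_smul, Prod.smul_snd, RingHom.id_apply, smul_sub] }

/-- The saddle function
`Ľ(χ, y) = ⟨x, c + ∑_i Q̃_i u_{i,s_i} + Aᵀ w + π⟩
  + ∑_i (⟨q̃_i, u_{i,s_i}⟩ + ∑_{l < s_i} ⟨ω_{i,l}, u_{i,l} - u_{i,s_i}⟩) - ⟨b, w⟩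
  - σ_X(π) - ∑_{i,l} δ_{U^{i,l}}(u_{i,l})`, with values in the extended reals. -/
def saddleFn (χ : Primal n dim k) (y : Dual n r dim k) : EReal :=
  open Classical in
  if ∀ i l, Dual.u y i l ∈ P.U i l then
    ((⟪Primal.x χ, P.c + ∑ i, P.Qt i (Dual.uLast y i) + P.A.adjoint (Dual.w y) + Dual.pi y⟫_ℝ
      + ∑ i, (⟪P.qt i, Dual.uLast y i⟫_ℝ
        + ∑ l : Fin (k i), ⟪Primal.om χ i l, Dual.u y i l.castSucc - Dual.uLast y i⟫_ℝ)
      - ⟪P.b, Dual.w y⟫_ℝ : ℝ) : EReal) - supportFn P.X (Dual.pi y)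
  else ⊥

/-- Primal half-step `χ - τ ∇_χ Ľ(·, y)`: it has `x`-block
`x - τ (c + ∑_i Q̃_i u_{i,s_i} + Aᵀ w + π)` and `ω_{i,l}`-block
`ω_{i,l} - τ (u_{i,l} - u_{i,s_i})`. -/
def primalStep (τ : ℝ) (χ : Primal n dim k) (y : Dual n r dim k) : Primal n dim k :=
  Primal.mk
    (Primal.x χ - τ • (P.c + ∑ i, P.Qt i (Dual.uLast y i) + P.A.adjoint (Dual.w y) + Dual.pi y))
    (fun i l => Primal.om χ i l - τ • (Dual.u y i l.castSucc - Dual.uLast y i))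

/-- The dual update of PAPC from `y` to `y'` with predictor `p`. -/
structure IsDualUpdate (θ : Fin m → ℝ) (θw θπ : ℝ) (p : Primal n dim k)
    (y y' : Dual n r dim k) : Prop where
  u_init : ∀ i (l : Fin (k i)), IsProjOn (P.U i l.castSucc)
    (Dual.u y i l.castSucc + θ i • Primal.om p i l) (Dual.u y' i l.castSucc)
  u_last : ∀ i, IsProjOn (P.U i (Fin.last (k i)))
    (Dual.uLast y i + θ i • ((P.Qt i).adjoint (Primal.x p) + P.qt i - ∑ l, Primal.om p i l))
    (Dual.uLast y' i)
  w_eq : Dual.w y' = Dual.w y + θw • (P.A (Primal.x p) - P.b)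
  pi_prox : IsProxOf θπ (supportFn P.X) (Dual.pi y + θπ • Primal.x p) (Dual.pi y')

/-- The sequences `(χ^k, y^k)` generated by PAPC: predictor `p^{k+1}`, dual update `y^{k+1}`,
corrector `χ^{k+1}`; the starting point has `u_{i,l}^0 ∈ U^{i,l}` and is otherwise arbitrary. -/
structure IsPAPC (τ : ℝ) (θ : Fin m → ℝ) (θw θπ : ℝ)
    (χ : ℕ → Primal n dim k) (y : ℕ → Dual n r dim k) : Prop where
  start : ∀ i l, Dual.u (y 0) i l ∈ P.U i l
  dual_step : ∀ j, P.IsDualUpdate θ θw θπ (P.primalStep τ (χ j) (y j)) (y j) (y (j + 1))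
  corrector : ∀ j, χ (j + 1) = P.primalStep τ (χ j) (y (j + 1))

end Problem

/-- `S = Diag(θ_1⁻¹ I, …, θ_m⁻¹ I, θ_w⁻¹ I, θ_π⁻¹ I)`. -/
def Sop (θ : Fin m → ℝ) (θw θπ : ℝ) : Dual n r dim k →L[ℝ] Dual n r dim k :=
  LinearMap.toContinuousLinearMap
    { toFun := fun y => Dual.mk (fun i l => (θ i)⁻¹ • Dual.u y i l)
        (θw⁻¹ • Dual.w y) (θπ⁻¹ • Dual.pi y)
      map_add' := by
        intro y y'
        refine (WithLp.ext_iff ..).2 (Prod.ext ((WithLp.ext_iff ..).2 (funext fun j => ?_))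
          ((WithLp.ext_iff ..).2 (Prod.ext ?_ ?_)))
        · simp [Dual.mk, Dual.u]
        · simp [Dual.mk, Dual.w]
        · simp [Dual.mk, Dual.pi]
      map_smul' := by
        intro t y
        refine (WithLp.ext_iff ..).2 (Prod.ext ((WithLp.ext_iff ..).2 (funext fun j => ?_))
          ((WithLp.ext_iff ..).2 (Prod.ext ?_ ?_)))
        · simp [Dual.mk, Dual.u, smul_comm t]
        · simp [Dual.mk, Dual.w, smul_comm t]
        · simp [Dual.mk, Dual.pi, smul_comm t] }

/-- `‖y‖_H² = ⟨y, H y⟩`. -/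
def sqNormOf {V : Type*} [NormedAddCommGroup V] [InnerProductSpace ℝ V] (H : V →L[ℝ] V)
    (y : V) : ℝ := ⟪y, H y⟫_ℝ

namespace Problem

variable (P : Problem n r m dim k)

/-- `H = S - τ Q̄ᵀ Q̄`. -/
def Hop (τ : ℝ) (θ : Fin m → ℝ) (θw θπ : ℝ) : Dual n r dim k →L[ℝ] Dual n r dim k :=
  Sop θ θw θπ - τ • (P.Qbar.adjoint ∘L P.Qbar)

/-- `λ̄ = (⟨c, x̂⟩ - v) / (- max_i f_i(x̂))`. -/
def lamBar (xhat : Vec n) (v : ℝ) : ℝ := (⟪P.c, xhat⟫_ℝ - v) / (-(⨆ i, P.f i xhat))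

/-- Smallest singular value of the `r × n` matrix `A` of full row rank (the `r`-th one in
decreasing order; Mathlib counts from zero). -/
def sigmaMin : ℝ := P.A.toLinearMap.singularValues (r - 1)

/-- `R_w = ((⟨c, x̂⟩ - v) / ε_x̂ + ‖c‖) / σ_min(A)`. -/
def Rw (xhat : Vec n) (e v : ℝ) : ℝ := 1 / P.sigmaMin * ((⟪P.c, xhat⟫_ℝ - v) / e + ‖P.c‖)

/-- `R_π = ‖c‖ + ‖A‖ R_w + λ̄ ∑_i ‖Q̃_i‖ (R_{i,s_i} + 1)`. -/
def Rpi (xhat : Vec n) (e v : ℝ) : ℝ :=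
  ‖P.c‖ + ‖P.A‖ * P.Rw xhat e v
    + P.lamBar xhat v * ∑ i, ‖P.Qt i‖ * (radius (P.Z i (Fin.last (k i))) + 1)

/-- `σ_i = ∑_l (1 + 4 R_{i,l}²)`. -/
def sig (i : Fin m) : ℝ := ∑ l, (1 + 4 * radius (P.Z i l) ^ 2)

end Problem

/-- `φ = max {2/θ_π, (4/τ) ∑_i s_i μ̄_i² (1 + 1/ε_i)² + 2 ‖π⁰‖² / θ_π}` with `s_i = k i + 1`. -/
def phiConst (k : Fin m → ℕ) (τ θπ : ℝ) (μ ε : Fin m → ℝ) (pi0 : Vec n) : ℝ :=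
  max (2 / θπ)
    (4 / τ * ∑ i, ((k i : ℝ) + 1) * μ i ^ 2 * (1 + 1 / ε i) ^ 2 + 2 * ‖pi0‖ ^ 2 / θπ)

/-- `Ω^{i,l} = {(ν, μ) : -μ̄_i ≤ μ ≤ 0, ‖ν‖ ≤ -μ / ε_i}`. -/
def OmegaSet {d : ℕ} (μbar ε : ℝ) : Set (Lift d) :=
  {o | -μbar ≤ o.snd ∧ o.snd ≤ 0 ∧ ‖o.fst‖ ≤ -o.snd / ε}

/-- `λ_i⁰ = max_l λ_{i,l}⁰`, where `u_{i,l}⁰ = (z̃_{i,l}⁰, λ_{i,l}⁰)`. -/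
def lamInit (y0 : Dual n r dim k) (i : Fin m) : ℝ := ⨆ l, (Dual.u y0 i l).snd

/-- An iterative method, given as the set of sequences `(x^k, λ^k, w^k)` it may produce, is
`ψ`-ergodically bounded with constants `φ, τ, β, θ_i, θ_w`. -/
def IsErgodicallyBounded (P : Problem n r m dim k)
    (Run : (ℕ → Vec n) → (ℕ → Fin m → ℝ) → (ℕ → Vec r) → Prop)
    (ψ : ℕ → ℝ) (φ τ β : ℝ) (θ : Fin m → ℝ) (θw : ℝ) : Prop :=
  0 ≤ φ ∧ 0 < τ ∧ 0 ≤ β ∧ (∀ i, 0 < θ i) ∧ 0 < θw ∧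
  (∀ N, 0 ≤ ψ N) ∧ AntitoneOn ψ (Set.Ici 1) ∧ Filter.Tendsto ψ Filter.atTop (nhds 0) ∧
  (∀ (x0 : Vec n) (lam0 : Fin m → ℝ) (w0 : Vec r), (∀ i, 0 ≤ lam0 i) →
    ∃ x lam w, Run x lam w ∧ x 0 = x0 ∧ lam 0 = lam0 ∧ w 0 = w0) ∧
  ∀ x lam w, Run x lam w →
    ∀ xs lams ws, P.IsSaddle xs lams ws → ∀ N : ℕ, 1 ≤ N →
      (∀ (α : ℝ) (lam' : Fin m → ℝ) (w' : Vec r), 0 ≤ α → (∀ i, 0 ≤ lam' i) →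
        P.lagrangian (ergodic x N) lam' w' - P.lagrangian xs lams ws
            + α * Metric.infDist (ergodic x N) P.X
          ≤ ψ N * (τ⁻¹ * ‖xs - x 0‖ ^ 2 + ∑ i, (θ i)⁻¹ * max (lam' i) (lam 0 i) ^ 2
            + θw⁻¹ * max ‖w'‖ ‖w 0‖ ^ 2 + φ * (1 + α ^ 2))) ∧
      0 ≤ P.lagrangian (ergodic x N) lams ws - P.lagrangian xs lams ws
        + β * Metric.infDist (ergodic x N) P.X

/-- The sequences `(x^k, λ^k, w^k)`, `λ_i^k = λ_{i,s_i}^k`, of PAPC started with a given `π⁰`,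
with `ω⁰ ∈ Ω` and with equal `λ_{i,l}⁰` for all `l`. -/
def PAPCRun (P : Problem n r m dim k) (τ : ℝ) (θ : Fin m → ℝ) (θw θπ : ℝ)
    (μ ε : Fin m → ℝ) (pi0 : Vec n)
    (x : ℕ → Vec n) (lam : ℕ → Fin m → ℝ) (w : ℕ → Vec r) : Prop :=
  ∃ (χ : ℕ → Primal n dim k) (y : ℕ → Dual n r dim k),
    P.IsPAPC τ θ θw θπ χ y ∧ Dual.pi (y 0) = pi0 ∧
    (∀ i l, Primal.om (χ 0) i l ∈ OmegaSet (μ i) (ε i)) ∧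
    (∀ i l, (Dual.u (y 0) i l).snd = (Dual.uLast (y 0) i).snd) ∧
    (∀ j, x j = Primal.x (χ j)) ∧ (∀ j i, lam j i = (Dual.uLast (y j) i).snd) ∧
    ∀ j, w j = Dual.w (y j)

end RobustPAPC

end

open RobustPAPC

/-! The ergodic gap (a) is a telescoping argument. The predictor equals χ^k + τ Q̄(y^k - y^{k-1}),
so the optimality conditions of the dual blocks combine into a variational inequality in the metric
H instead of S. With a three-point inequality, the gap of each iterate is at most a difference of
consecutive squared distances (`IsDualUpdate.inner_le`, `IsPAPC.exists_gap_bound`). The finite part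
of Ľ is affine in each argument, so it averages exactly.

The upper bound on L tests this gap at chosen points. On the dual side, equal copies u_{i,l} = λ_i
(z_i, 1), with z_i a worst case for the average x̄, recover L(x̄, (λ, w)), and a vector π of norm at
most α along x̄ minus its projection onto X adds α dist(x̄, X). On the primal side, feasibility of
x* puts Q̃_iᵀ x* + q̃_i in the polar of ⋂_l U^{i,l}. This polar is the sum of the polars of the
U^{i,l} (`exists_polar_decomposition`), and the summands give an ω with Ľ((x*, ω), ·) ≤ cᵀx*. They
lie in Ω, which controls their distance to ω⁰.

The lower bound comes from the Slater point: multipliers exist by separation, they are bounded by λ̄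
and R_w, hence L is Lipschitz in x with constant β, and leaving X gains at most β dist(x̄, X)
(`IsMultiplier.le_lagrangian_add`). For (d), the upper bound is applied to multipliers shifted along
the constraint violations, to zero, or to doubled multipliers; in the first and last cases it is
combined with the lower bound. -/

open RobustPAPC

namespace RobustPAPC

/-! ### Projections, polar cones, proximal maps and singular values. -/

section Convex

variable {V : Type*} [NormedAddCommGroup V] [InnerProductSpace ℝ V]

theorem isProjOn_of_inner_le_zero {K : Set V} {v p : V} (hp : p ∈ K)
    (h : ∀ q ∈ K, ⟪v - p, q - p⟫_ℝ ≤ 0) : IsProjOn K v p := by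
  refine ⟨hp, fun q hq => ?_⟩
  have h1 := h q hq
  have h2 : ‖q - v‖ ^ 2 = ‖q - p‖ ^ 2 - 2 * ⟪v - p, q - p⟫_ℝ + ‖p - v‖ ^ 2 := by
    have : q - v = (q - p) - (v - p) := by abel
    rw [this, norm_sub_sq_real, real_inner_comm, norm_sub_rev v p]
  refine abs_le_of_sq_le_sq' ?_ (norm_nonneg _) |>.2
  nlinarith [sq_nonneg ‖q - p‖]

theorem IsProjOn.inner_le_zero {K : Set V} (hK : Convex ℝ K) {v p : V} (h : IsProjOn K v p)
    {q : V} (hq : q ∈ K) : ⟪v - p, q - p⟫_ℝ ≤ 0 := by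
  refine (norm_eq_iInf_iff_real_inner_le_zero hK h.1).1 ?_ q hq
  have : Nonempty K := ⟨⟨p, h.1⟩⟩
  refine le_antisymm (le_ciInf fun w => ?_) ?_
  · rw [norm_sub_rev, norm_sub_rev v]
    exact h.2 w w.2
  · exact ciInf_le (f := fun w : K => ‖v - w‖) ⟨0, by rintro _ ⟨w, rfl⟩; positivity⟩ ⟨p, h.1⟩

theorem exists_isProjOn [CompleteSpace V] {K : Set V} (hne : K.Nonempty) (hcl : IsClosed K)
    (hK : Convex ℝ K) (v : V) : ∃ p, IsProjOn K v p := by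
  obtain ⟨p, hp, h⟩ := exists_norm_eq_iInf_of_complete_convex hne hcl.isComplete hK v
  exact ⟨p, isProjOn_of_inner_le_zero hp ((norm_eq_iInf_iff_real_inner_le_zero hK hp).1 h)⟩

/-- The polar of an intersection of closed convex cones is in general only the closure of the sum of
the polars. The functional `h` removes the closure: it is additive and dominates the norm on every
polar, so the summands of a convergent sequence of sums stay bounded. A point outside the sum is
then separated from it by a vector that lies in every bipolar, that is, in every cone. -/
theorem exists_polar_decomposition [FiniteDimensional ℝ V] {ι : Type*} [Fintype ι]
    (U : ι → Set V) (hcl : ∀ l, IsClosed (U l)) (hconv : ∀ l, Convex ℝ (U l))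
    (h0 : ∀ l, (0 : V) ∈ U l) (hcone : ∀ l, ∀ u ∈ U l, ∀ t : ℝ, 0 ≤ t → t • u ∈ U l)
    (h : V →L[ℝ] ℝ) (hh : ∀ l ω, (∀ u ∈ U l, ⟪ω, u⟫_ℝ ≤ 0) → ‖ω‖ ≤ h ω)
    (a : V) (ha : ∀ u, (∀ l, u ∈ U l) → ⟪a, u⟫_ℝ ≤ 0) :
    ∃ ω : ι → V, (∀ l, ∀ u ∈ U l, ⟪ω l, u⟫_ℝ ≤ 0) ∧ ∑ l, ω l = a := by
  classical
  let pol : ι → Set V := fun l => {ω | ∀ u ∈ U l, ⟪ω, u⟫_ℝ ≤ 0}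
  let K : Set V := (fun ω : ι → V => ∑ l, ω l) '' Set.univ.pi pol
  have hpol_cl : ∀ l, IsClosed (pol l) := fun l => by
    have : pol l = ⋂ u ∈ U l, {ω | ⟪ω, u⟫_ℝ ≤ 0} := by ext; simp [pol]
    rw [this]
    exact isClosed_biInter fun u _ => isClosed_le (by fun_prop) continuous_const
  have hKcl : IsClosed K := by
    refine isClosed_of_closure_subset fun b hb => ?_
    have hopen : IsOpen {ω : V | h ω < h b + 1} := isOpen_lt h.continuous continuous_const
    have hb' : b ∈ closure ({ω : V | h ω < h b + 1} ∩ K) :=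
      hopen.inter_closure ⟨by simp, hb⟩
    let B : Set (ι → V) := Set.univ.pi fun l => pol l ∩ Metric.closedBall 0 (h b + 1)
    have hB : IsCompact B :=
      isCompact_univ_pi fun l => (isCompact_closedBall 0 (h b + 1)).inter_left (hpol_cl l)
    have hBK : IsClosed ((fun ω : ι → V => ∑ l, ω l) '' B) :=
      (hB.image (by fun_prop)).isClosed
    have hsub : {ω : V | h ω < h b + 1} ∩ K ⊆ (fun ω : ι → V => ∑ l, ω l) '' B := by
      rintro _ ⟨hlt, ω, hω, rfl⟩
      refine ⟨ω, fun l _ => ⟨hω l trivial, ?_⟩, rfl⟩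
      have hnn : ∀ l, 0 ≤ h (ω l) := fun l => (norm_nonneg _).trans (hh l _ (hω l trivial))
      have h1 : h (ω l) ≤ ∑ l, h (ω l) :=
        Finset.single_le_sum (f := fun l => h (ω l)) (fun l _ => hnn l) (Finset.mem_univ l)
      have h2 : (∑ l, h (ω l)) < h b + 1 := by simpa using hlt
      rw [mem_closedBall_zero_iff]
      exact (hh l _ (hω l trivial)).trans (h1.trans h2.le)
    obtain ⟨ω, hω, rfl⟩ := closure_minimal hsub hBK hb'
    exact ⟨ω, fun l hl => (hω l hl).1, rfl⟩
  have hKconv : Convex ℝ K := by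
    refine Convex.is_linear_image (f := fun ω : ι → V => ∑ l, ω l) (convex_pi fun l _ => ?_) ?_
    · intro x hx y hy s t hs ht _ u hu
      have := hx u hu
      have := hy u hu
      simp only [inner_add_left, real_inner_smul_left]
      nlinarith
    · constructor
      · intro x y; simp [Finset.sum_add_distrib]
      · intro c x; simp [Finset.smul_sum]
  suffices haK : a ∈ K by
    obtain ⟨ω, hω, rfl⟩ := haK
    exact ⟨ω, fun l => hω l trivial, rfl⟩
  by_contra haK
  obtain ⟨f, s, hf1, hf2⟩ := geometric_hahn_banach_closed_point hKconv hKcl haK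
  set u : V := (InnerProductSpace.toDual ℝ V).symm f with hu
  have hfu : ∀ x, f x = ⟪u, x⟫_ℝ := fun x => by simp [hu]
  have h0K : (0 : V) ∈ K := ⟨0, fun l _ u _ => by simp, by simp⟩
  have hs : 0 < s := by simpa using hf1 0 h0K
  have hpolu : ∀ l, ∀ ω ∈ pol l, ⟪u, ω⟫_ℝ ≤ 0 := by
    intro l ω hω
    by_contra hpos
    push Not at hpos
    -- The multiple is chosen so that the separating functional takes exactly the value `s` on a
    -- point of `K`, against the strict separation.
    have hmem : (s / ⟪u, ω⟫_ℝ) • ω ∈ K := by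
      refine ⟨Pi.single l ((s / ⟪u, ω⟫_ℝ) • ω), fun l' _ => ?_, by simp⟩
      by_cases hl : l' = l
      · subst hl
        intro v hv
        rw [Pi.single_eq_same, real_inner_smul_left]
        exact mul_nonpos_of_nonneg_of_nonpos (by positivity) (hω v hv)
      · intro v _
        simp [Pi.single_eq_of_ne hl]
    have := hf1 _ hmem
    rw [hfu, real_inner_smul_right, div_mul_cancel₀ _ hpos.ne'] at this
    exact lt_irrefl _ this
  have huU : ∀ l, u ∈ U l := by
    intro l
    obtain ⟨p, hp⟩ := exists_isProjOn ⟨0, h0 l⟩ (hcl l) (hconv l) u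
    have h1 := fun q (hq : q ∈ U l) => hp.inner_le_zero (hconv l) hq
    -- Both 0 and 2p lie in the cone, and the projection inequality at these two points has opposite
    -- signs.
    have h2 : ⟪u - p, p⟫_ℝ = 0 := by
      have e1 := h1 0 (h0 l)
      have e2 := h1 _ (hcone l p hp.1 2 (by norm_num))
      have : (2 : ℝ) • p - p = p := by rw [two_smul]; abel
      rw [this] at e2
      rw [zero_sub, inner_neg_right] at e1
      linarith
    have h3 : u - p ∈ pol l := fun q hq => by
      have := h1 q hq
      rw [inner_sub_right, h2] at this
      linarith
    have h4 := hpolu l _ h3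
    have h5 : ⟪u - p, u - p⟫_ℝ ≤ 0 := by
      rw [inner_sub_right, h2, real_inner_comm]
      linarith
    have h6 : u - p = 0 := real_inner_self_nonpos.1 h5
    rw [sub_eq_zero.1 h6]
    exact hp.1
  have := ha u huU
  rw [hfu, real_inner_comm] at hf2
  linarith

/-- Expand the square of y - b = (y - a) + (a - b) in the metric H and drop the nonnegative square
of a - b. -/
theorem real_inner_apply_sub_le_of_isPositive [CompleteSpace V] {H : V →L[ℝ] V} (hH : H.IsPositive)
    (a b y : V) :
    ⟪H (a - b), y - a⟫_ℝ ≤ (sqNormOf H (y - b) - sqNormOf H (y - a)) / 2 := by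
  have h1 : y - b = (y - a) + (a - b) := by abel
  have h2 : 0 ≤ ⟪a - b, H (a - b)⟫_ℝ := hH.inner_nonneg_right _
  have h3 : ⟪a - b, H (y - a)⟫_ℝ = ⟪H (a - b), y - a⟫_ℝ := (hH.isSymmetric _ _).symm
  simp only [sqNormOf, h1, map_add, inner_add_left, inner_add_right]
  rw [h3, real_inner_comm (H (a - b)) (y - a)]
  linarith

end Convex

/-- Moreau's identity, where ξ is the projection of v/t onto X. The support function lies above the
linear form ⟨·, ξ⟩ and meets it at v - tξ; with the linear form in its place, the prox objective is
a square centred at that same point. This yields optimality and uniqueness together. -/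
theorem isProxOf_supportFn_of_mem {n : ℕ} {X : Set (Vec n)} {t : ℝ} (ht : 0 < t) {v ξ : Vec n}
    (hξ : ξ ∈ X) (h : ∀ x ∈ X, ⟪v - t • ξ, x - ξ⟫_ℝ ≤ 0) :
    IsProxOf t (supportFn X) v (v - t • ξ) ∧
      ∀ p, IsProxOf t (supportFn X) v p → p = v - t • ξ := by
  have hσ : supportFn X (v - t • ξ) = ((⟪v - t • ξ, ξ⟫_ℝ : ℝ) : EReal) := by
    refine le_antisymm (iSup₂_le fun x hx => ?_) (le_iSup₂_of_le ξ hξ le_rfl)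
    have := h x hx
    rw [inner_sub_right] at this
    exact EReal.coe_le_coe_iff.2 (by linarith)
  have hge : ∀ q, ((⟪q, ξ⟫_ℝ : ℝ) : EReal) ≤ supportFn X q := fun q =>
    le_iSup₂_of_le ξ hξ le_rfl
  have key : ∀ q : Vec n, ⟪q, ξ⟫_ℝ + ‖q - v‖ ^ 2 / (2 * t)
      = ⟪v - t • ξ, ξ⟫_ℝ + ‖v - t • ξ - v‖ ^ 2 / (2 * t)
        + ‖q - (v - t • ξ)‖ ^ 2 / (2 * t) := by
    intro q
    have e1 : q - v = (q - (v - t • ξ)) - t • ξ := by abel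
    have e2 : v - t • ξ - v = -(t • ξ) := by abel
    rw [e2, norm_neg]
    set d := q - (v - t • ξ) with hd
    have e3 : q = d + (v - t • ξ) := by rw [hd]; abel
    rw [e1, norm_sub_sq_real, real_inner_smul_right, e3, inner_add_left]
    field_simp
    ring
  refine ⟨fun q => ?_, fun p hp => ?_⟩
  · rw [hσ]
    refine le_trans ?_ (add_le_add_left (hge q) _)
    rw [← EReal.coe_add, ← EReal.coe_add, EReal.coe_le_coe_iff, key q]
    have : 0 ≤ ‖q - (v - t • ξ)‖ ^ 2 / (2 * t) := by positivity
    linarith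
  · have h1 := (add_le_add_left (hge p) _).trans (hp (v - t • ξ))
    rw [hσ, ← EReal.coe_add, ← EReal.coe_add, EReal.coe_le_coe_iff, key p] at h1
    have h2 : ‖p - (v - t • ξ)‖ ^ 2 / (2 * t) ≤ 0 := by linarith
    have h3 : ‖p - (v - t • ξ)‖ ^ 2 ≤ 0 := by
      by_contra hc
      push Not at hc
      have : 0 < ‖p - (v - t • ξ)‖ ^ 2 / (2 * t) := by positivity
      linarith
    have h4 : ‖p - (v - t • ξ)‖ = 0 := by
      have := sq_nonneg ‖p - (v - t • ξ)‖
      exact pow_eq_zero_iff two_ne_zero |>.1 (le_antisymm h3 this)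
    exact sub_eq_zero.1 (norm_eq_zero.1 h4)

theorem exists_prox_point {n : ℕ} {X : Set (Vec n)} (hne : X.Nonempty) (hcl : IsClosed X)
    (hX : Convex ℝ X) {t : ℝ} (ht : 0 < t) (v : Vec n) :
    ∃ ξ ∈ X, ∀ x ∈ X, ⟪v - t • ξ, x - ξ⟫_ℝ ≤ 0 := by
  obtain ⟨ξ, hξ⟩ := exists_isProjOn hne hcl hX (t⁻¹ • v)
  refine ⟨ξ, hξ.1, fun x hx => ?_⟩
  have h1 := hξ.inner_le_zero hX hx
  have h2 : v - t • ξ = t • (t⁻¹ • v - ξ) := by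
    rw [smul_sub, smul_smul, mul_inv_cancel₀ ht.ne', one_smul]
  rw [h2, real_inner_smul_left]
  exact mul_nonpos_of_nonneg_of_nonpos ht.le h1

theorem exists_isProxOf_supportFn {n : ℕ} {X : Set (Vec n)} (hne : X.Nonempty) (hcl : IsClosed X)
    (hX : Convex ℝ X) {t : ℝ} (ht : 0 < t) (v : Vec n) : ∃ p, IsProxOf t (supportFn X) v p := by
  obtain ⟨ξ, hξ, h⟩ := exists_prox_point hne hcl hX ht v
  exact ⟨_, (isProxOf_supportFn_of_mem ht hξ h).1⟩

theorem IsProxOf.exists_supporting_point {n : ℕ} {X : Set (Vec n)} (hne : X.Nonempty)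
    (hcl : IsClosed X) (hX : Convex ℝ X) {t : ℝ} (ht : 0 < t) {v p : Vec n}
    (hp : IsProxOf t (supportFn X) v p) :
    ∃ ξ ∈ X, p = v - t • ξ ∧ ∀ x ∈ X, ⟪p, x⟫_ℝ ≤ ⟪p, ξ⟫_ℝ := by
  obtain ⟨ξ, hξ, h⟩ := exists_prox_point hne hcl hX ht v
  have := (isProxOf_supportFn_of_mem ht hξ h).2 p hp
  refine ⟨ξ, hξ, this, fun x hx => ?_⟩
  have h1 := h x hx
  rw [← this, inner_sub_right] at h1
  linarith

/-- In an eigenbasis of TᵀT with coordinates c_j of x, the two squared norms are ∑ σ_j⁴ c_j² and ∑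
σ_j² c_j², and the nonzero σ_j are at least σ_{r-1}. This converts a bound on Aᵀw into one on w. -/
theorem singularValues_mul_norm_le_norm_adjoint {E F : Type*} [NormedAddCommGroup E]
    [InnerProductSpace ℝ E] [FiniteDimensional ℝ E] [NormedAddCommGroup F] [InnerProductSpace ℝ F]
    [FiniteDimensional ℝ F] (T : E →ₗ[ℝ] F) {r : ℕ}
    (hr : Module.finrank ℝ (LinearMap.range T) = r) (x : E) :
    T.singularValues (r - 1) * ‖T x‖ ≤ ‖T.adjoint (T x)‖ := by
  set hS := T.isSymmetric_adjoint_comp_self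
  set B := hS.eigenvectorBasis rfl
  have hσ := T.singularValues_nonneg (r - 1)
  have hB : ∀ j, ⟪B j, T.adjoint (T x)⟫_ℝ = T.singularValues j ^ 2 * ⟪B j, x⟫_ℝ := by
    intro j
    have h1 : (LinearMap.adjoint T ∘ₗ T) (B j) = (T.singularValues j ^ 2) • B j := by
      rw [T.sq_singularValues_fin rfl]
      exact hS.apply_eigenvectorBasis rfl j
    rw [← LinearMap.comp_apply (LinearMap.adjoint T) T x, ← hS, h1, real_inner_smul_left]
  have e1 : ‖T.adjoint (T x)‖ ^ 2 = ∑ j : Fin (Module.finrank ℝ E), (T.singularValues j ^ 2 * ⟪B j, x⟫_ℝ) ^ 2 := by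
    rw [← B.sum_sq_norm_inner_right]
    simp only [hB, Real.norm_eq_abs, sq_abs]
  have e2 : ‖T x‖ ^ 2 = ∑ j : Fin (Module.finrank ℝ E),
      ⟪B j, x⟫_ℝ * (T.singularValues j ^ 2 * ⟪B j, x⟫_ℝ) := by
    rw [← real_inner_self_eq_norm_sq, ← LinearMap.adjoint_inner_right,
      ← B.sum_inner_mul_inner]
    simp only [hB]
    exact Finset.sum_congr rfl fun j _ => by rw [real_inner_comm]
  refine abs_le_of_sq_le_sq' ?_ (norm_nonneg _) |>.2
  rw [mul_pow, e1, e2, Finset.mul_sum]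
  refine Finset.sum_le_sum fun j _ => ?_
  -- For r = 0 the index r - 1 truncates to 0, and only the second case, with σ_j = 0, occurs.
  rcases lt_or_ge (j : ℕ) r with hj | hj
  · have h1 : T.singularValues (r - 1) ≤ T.singularValues j :=
      T.singularValues_antitone (by omega)
    have h2 : T.singularValues (r - 1) ^ 2 ≤ T.singularValues j ^ 2 := by gcongr
    have h3 : 0 ≤ T.singularValues j ^ 2 * ⟪B j, x⟫_ℝ ^ 2 := by positivity
    nlinarith
  · have : T.singularValues j = 0 := T.singularValues_eq_zero_iff_le_finrank_range.2 (hr ▸ hj)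
    simp [this]

end RobustPAPC

/-! ### Coordinates of the product spaces, lifted cones and the biaffine coupling. -/

namespace RobustPAPC

variable {n r m : ℕ} {dim k : Fin m → ℕ}

theorem lift_inner {d : ℕ} (a b : Lift d) : ⟪a, b⟫_ℝ = ⟪a.fst, b.fst⟫_ℝ + a.snd * b.snd := by
  rw [WithLp.prod_inner_apply]
  simp [mul_comm]

theorem lift_norm_sq {d : ℕ} (a : Lift d) : ‖a‖ ^ 2 = ‖a.fst‖ ^ 2 + a.snd ^ 2 := by
  rw [← real_inner_self_eq_norm_sq, lift_inner, real_inner_self_eq_norm_sq, sq a.snd]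

namespace Primal

@[simp] theorem x_mk (a : Vec n) (o : ∀ i, Fin (k i) → Lift (dim i)) : x (mk a o) = a := rfl

@[simp] theorem om_mk (a : Vec n) (o : ∀ i, Fin (k i) → Lift (dim i)) (i : Fin m)
    (l : Fin (k i)) : om (mk a o) i l = o i l := rfl

@[simp] theorem x_sub (a b : Primal n dim k) : x (a - b) = x a - x b := rfl

@[simp] theorem om_sub (a b : Primal n dim k) (i : Fin m) (l : Fin (k i)) :
    om (a - b) i l = om a i l - om b i l := rfl

@[simp] theorem x_add (a b : Primal n dim k) : x (a + b) = x a + x b := rfl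

@[simp] theorem om_add (a b : Primal n dim k) (i : Fin m) (l : Fin (k i)) :
    om (a + b) i l = om a i l + om b i l := rfl

@[simp] theorem x_smul (t : ℝ) (a : Primal n dim k) : x (t • a) = t • x a := rfl

@[simp] theorem om_smul (t : ℝ) (a : Primal n dim k) (i : Fin m) (l : Fin (k i)) :
    om (t • a) i l = t • om a i l := rfl

theorem ext' {a b : Primal n dim k} (hx : x a = x b) (ho : ∀ i l, om a i l = om b i l) :
    a = b :=
  (WithLp.ext_iff ..).2 (Prod.ext hx ((WithLp.ext_iff ..).2 (funext fun j => ho j.1 j.2)))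

theorem inner_eq (a b : Primal n dim k) :
    ⟪a, b⟫_ℝ = ⟪x a, x b⟫_ℝ + ∑ i, ∑ l, ⟪om a i l, om b i l⟫_ℝ := by
  rw [WithLp.prod_inner_apply]
  refine congrArg₂ _ rfl ?_
  rw [PiLp.inner_apply, Fintype.sum_sigma]
  rfl

theorem norm_sq_eq (a : Primal n dim k) :
    ‖a‖ ^ 2 = ‖x a‖ ^ 2 + ∑ i, ∑ l, ‖om a i l‖ ^ 2 := by
  simp only [← real_inner_self_eq_norm_sq, inner_eq]

/-- The component `x` as a linear map. -/
noncomputable def xLin : Primal n dim k →ₗ[ℝ] Vec n where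
  toFun := x
  map_add' _ _ := rfl
  map_smul' _ _ := rfl

theorem x_ergodic (χ : ℕ → Primal n dim k) (N : ℕ) :
    x (ergodic χ N) = ergodic (fun j => x (χ j)) N := by
  change xLin (ergodic χ N) = _
  simp only [ergodic, map_smul, map_sum]
  rfl

end Primal

namespace Dual

@[simp] theorem u_mk (a : ∀ i, Fin (k i + 1) → Lift (dim i)) (b : Vec r) (c : Vec n) (i : Fin m)
    (l : Fin (k i + 1)) : u (mk a b c) i l = a i l := rfl

@[simp] theorem w_mk (a : ∀ i, Fin (k i + 1) → Lift (dim i)) (b : Vec r) (c : Vec n) :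
    w (mk a b c) = b := rfl

@[simp] theorem pi_mk (a : ∀ i, Fin (k i + 1) → Lift (dim i)) (b : Vec r) (c : Vec n) :
    pi (mk a b c) = c := rfl

@[simp] theorem u_sub (a b : Dual n r dim k) (i : Fin m) (l : Fin (k i + 1)) :
    u (a - b) i l = u a i l - u b i l := rfl

@[simp] theorem w_sub (a b : Dual n r dim k) : w (a - b) = w a - w b := rfl

@[simp] theorem pi_sub (a b : Dual n r dim k) : pi (a - b) = pi a - pi b := rfl

theorem inner_eq (a b : Dual n r dim k) :
    ⟪a, b⟫_ℝ = ∑ i, ∑ l, ⟪u a i l, u b i l⟫_ℝ + ⟪w a, w b⟫_ℝ + ⟪pi a, pi b⟫_ℝ := by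
  rw [WithLp.prod_inner_apply, PiLp.inner_apply, Fintype.sum_sigma, WithLp.prod_inner_apply,
    add_assoc]
  rfl

/-- The component `u_{i,l}` as a linear map. -/
noncomputable def uLin (i : Fin m) (l : Fin (k i + 1)) : Dual n r dim k →ₗ[ℝ] Lift (dim i) where
  toFun y := u y i l
  map_add' _ _ := rfl
  map_smul' _ _ := rfl

/-- The component `π` as a linear map. -/
noncomputable def piLin : Dual n r dim k →ₗ[ℝ] Vec n where
  toFun := pi
  map_add' _ _ := rfl
  map_smul' _ _ := rfl

theorem u_ergodic (y : ℕ → Dual n r dim k) (N : ℕ) (i : Fin m) (l : Fin (k i + 1)) :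
    u (ergodic y N) i l = ∑ j ∈ Finset.Icc 1 N, (1 / (N : ℝ)) • u (y j) i l := by
  change uLin i l (ergodic y N) = _
  simp only [ergodic, map_smul, map_sum, Finset.smul_sum]
  rfl

theorem pi_ergodic (y : ℕ → Dual n r dim k) (N : ℕ) :
    pi (ergodic y N) = (1 / (N : ℝ)) • ∑ j ∈ Finset.Icc 1 N, pi (y j) := by
  change piLin (ergodic y N) = _
  simp only [ergodic, map_smul, map_sum]
  rfl

end Dual

theorem inner_ergodic_left {V : Type*} [NormedAddCommGroup V] [InnerProductSpace ℝ V]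
    (v : ℕ → V) (N : ℕ) (a : V) :
    ⟪ergodic v N, a⟫_ℝ = 1 / (N : ℝ) * ∑ j ∈ Finset.Icc 1 N, ⟪v j, a⟫_ℝ := by
  rw [ergodic, real_inner_smul_left, sum_inner]

theorem inner_Sop (θ : Fin m → ℝ) (θw θπ : ℝ) (a b : Dual n r dim k) :
    ⟪Sop θ θw θπ a, b⟫_ℝ = ∑ i, ∑ l, (θ i)⁻¹ * ⟪Dual.u a i l, Dual.u b i l⟫_ℝ
      + θw⁻¹ * ⟪Dual.w a, Dual.w b⟫_ℝ + θπ⁻¹ * ⟪Dual.pi a, Dual.pi b⟫_ℝ := by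
  rw [Dual.inner_eq]
  simp only [← real_inner_smul_left]
  rfl

namespace Problem

variable (P : Problem n r m dim k)

/-- When the last coordinate tends to 0, u no longer determines z; compactness of Z^{i,l} supplies a
limit for z along a subsequence. -/
theorem isClosed_U (i : Fin m) (l : Fin (k i + 1)) : IsClosed (P.U i l) := by
  refine IsSeqClosed.isClosed fun u a hu ha => ?_
  have h1 : Filter.Tendsto (fun j => (u j).snd) Filter.atTop (nhds a.snd) :=
    ((WithLp.sndL 2 ℝ (Vec (dim i)) ℝ).continuous.tendsto a).comp ha
  have h2 : Filter.Tendsto (fun j => (u j).fst) Filter.atTop (nhds a.fst) :=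
    ((WithLp.fstL 2 ℝ (Vec (dim i)) ℝ).continuous.tendsto a).comp ha
  choose h0 z hz hzu using hu
  obtain ⟨z0, hz0, φ, hφ, hlim⟩ := (P.Z_compact i l).tendsto_subseq hz
  refine ⟨ge_of_tendsto' h1 h0, z0, hz0, tendsto_nhds_unique (h2.comp hφ.tendsto_atTop) ?_⟩
  have : (fun j => (u j).fst) ∘ φ = fun j => (u (φ j)).snd • z (φ j) := funext fun j => hzu _
  rw [this]
  exact (h1.comp hφ.tendsto_atTop).smul hlim

theorem convex_U (i : Fin m) (l : Fin (k i + 1)) : Convex ℝ (P.U i l) := by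
  rintro a ⟨ha, z, hz, hza⟩ b ⟨hb, z', hz', hzb⟩ s t hs ht -
  refine ⟨add_nonneg (mul_nonneg hs ha) (mul_nonneg ht hb), ?_⟩
  change ∃ q ∈ P.Z i l, s • a.fst + t • b.fst = (s * a.snd + t * b.snd) • q
  rw [hza, hzb]
  have h1 : 0 ≤ s * a.snd := mul_nonneg hs ha
  have h2 : 0 ≤ t * b.snd := mul_nonneg ht hb
  -- The new z averages the two given ones with weights proportional to the scaled last coordinates.
  -- If both vanish, any point of Z^{i,l} serves.
  rcases (add_nonneg h1 h2).eq_or_lt with h | h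
  · have h3 : s * a.snd = 0 := by linarith
    have h4 : t * b.snd = 0 := by linarith
    exact ⟨z, hz, by simp [smul_smul, h3, h4]⟩
  · refine ⟨_, P.Z_convex i l hz hz' (div_nonneg h1 h.le) (div_nonneg h2 h.le) ?_, ?_⟩
    · field_simp
    · rw [smul_add, smul_smul, smul_smul, smul_smul, smul_smul, mul_div_cancel₀ _ h.ne',
        mul_div_cancel₀ _ h.ne']

theorem smul_mem_U {i : Fin m} {l : Fin (k i + 1)} {u : Lift (dim i)} (hu : u ∈ P.U i l) {t : ℝ}
    (ht : 0 ≤ t) : t • u ∈ P.U i l := by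
  obtain ⟨h, z, hz, hzu⟩ := hu
  refine ⟨mul_nonneg ht h, z, hz, ?_⟩
  change t • u.fst = (t * u.snd) • z
  rw [hzu, smul_smul]

theorem mkLift_smul_mem_U {i : Fin m} {l : Fin (k i + 1)} {z : Vec (dim i)} (hz : z ∈ P.Z i l)
    {t : ℝ} (ht : 0 ≤ t) : mkLift (t • z) t ∈ P.U i l :=
  ⟨ht, z, hz, rfl⟩

/-- The finite bilinear part of the saddle function. -/
noncomputable def coupling (χ : Primal n dim k) (y : Dual n r dim k) : ℝ :=
  ⟪Primal.x χ, P.c + ∑ i, P.Qt i (Dual.uLast y i) + P.A.adjoint (Dual.w y) + Dual.pi y⟫_ℝ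
    + ∑ i, (⟪P.qt i, Dual.uLast y i⟫_ℝ
      + ∑ l : Fin (k i), ⟪Primal.om χ i l, Dual.u y i l.castSucc - Dual.uLast y i⟫_ℝ)
    - ⟪P.b, Dual.w y⟫_ℝ

/-- The cost vector `(c, 0)` in the primal space. -/
noncomputable def costVec : Primal n dim k := Primal.mk P.c 0

/-- The vector representing the linear terms in the dual variables. -/
noncomputable def offsetVec : Dual n r dim k :=
  Dual.mk (fun i l => if l = Fin.last (k i) then P.qt i else 0) (-P.b) 0

theorem inner_offsetVec (y : Dual n r dim k) :
    ⟪P.offsetVec, y⟫_ℝ = ∑ i, ⟪P.qt i, Dual.uLast y i⟫_ℝ - ⟪P.b, Dual.w y⟫_ℝ := by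
  rw [Dual.inner_eq]
  simp [offsetVec, Fin.sum_univ_castSucc, Fin.castSucc_ne_last, Dual.uLast, sub_eq_add_neg]

theorem Qbar_apply (y : Dual n r dim k) : P.Qbar y = Primal.mk
    (∑ i, P.Qt i (Dual.uLast y i) + P.A.adjoint (Dual.w y) + Dual.pi y)
    (fun i l => Dual.u y i l.castSucc - Dual.uLast y i) := rfl

theorem coupling_eq (χ : Primal n dim k) (y : Dual n r dim k) :
    P.coupling χ y = ⟪χ, P.costVec + P.Qbar y⟫_ℝ + ⟪P.offsetVec, y⟫_ℝ := by
  rw [inner_offsetVec, Primal.inner_eq, Qbar_apply, costVec, coupling]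
  simp only [Primal.x_add, Primal.om_add, Primal.x_mk, Primal.om_mk, Pi.zero_apply, zero_add,
    Finset.sum_add_distrib, add_assoc]
  ring

theorem primalStep_eq (τ : ℝ) (χ : Primal n dim k) (y : Dual n r dim k) :
    P.primalStep τ χ y = χ - τ • (P.costVec + P.Qbar y) := by
  refine Primal.ext' ?_ fun i l => ?_
  · simp [primalStep, costVec, Qbar_apply, add_assoc]
  · simp [primalStep, costVec, Qbar_apply]

theorem coupling_ergodic_left (χ : ℕ → Primal n dim k) {N : ℕ} (hN : 1 ≤ N)
    (y : Dual n r dim k) :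
    P.coupling (ergodic χ N) y = 1 / (N : ℝ) * ∑ j ∈ Finset.Icc 1 N, P.coupling (χ j) y := by
  simp only [coupling_eq, inner_ergodic_left, Finset.sum_add_distrib, Finset.sum_const,
    Nat.card_Icc, add_tsub_cancel_right, nsmul_eq_mul]
  have : (N : ℝ) ≠ 0 := by positivity
  field_simp

theorem coupling_ergodic_right (χ : Primal n dim k) {N : ℕ} (hN : 1 ≤ N)
    (y : ℕ → Dual n r dim k) :
    P.coupling χ (ergodic y N) = 1 / (N : ℝ) * ∑ j ∈ Finset.Icc 1 N, P.coupling χ (y j) := by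
  have h0 : (N : ℝ) ≠ 0 := by positivity
  simp only [coupling_eq, inner_add_right, Finset.sum_add_distrib, Finset.sum_const,
    Nat.card_Icc, add_tsub_cancel_right, nsmul_eq_mul]
  simp only [ergodic, map_smul, map_sum, real_inner_smul_right, inner_sum]
  field_simp

/-! ### One PAPC step and the ergodic gap. -/

variable {P}

/-- Each block contributes its optimality condition divided by its step size. The real numbers `s`
and `s'` are upper bounds for the values of σ_X at `y'` and `q`, which keeps the argument out of the
extended reals; `s` does not depend on `q`, so the steps can be summed. -/
theorem IsDualUpdate.inner_le {θ : Fin m → ℝ} {θw θπ : ℝ} (hθ : ∀ i, 0 < θ i) (hθw : 0 < θw)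
    (hθπ : 0 < θπ) (hne : P.X.Nonempty) {p : Primal n dim k} {y y' : Dual n r dim k}
    (h : P.IsDualUpdate θ θw θπ p y y') :
    ∃ s : ℝ, (∀ x ∈ P.X, ⟪Dual.pi y', x⟫_ℝ ≤ s) ∧
      ∀ (q : Dual n r dim k) (s' : ℝ), (∀ i l, Dual.u q i l ∈ P.U i l) →
        (∀ x ∈ P.X, ⟪Dual.pi q, x⟫_ℝ ≤ s') →
        ⟪p, P.Qbar (q - y')⟫_ℝ + ⟪P.offsetVec, q - y'⟫_ℝ - ⟪Sop θ θw θπ (y' - y), q - y'⟫_ℝ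
          ≤ s' - s := by
  obtain ⟨ξ, hξ, hpi, hsup⟩ := h.pi_prox.exists_supporting_point hne P.X_closed P.X_convex hθπ
  refine ⟨⟪Dual.pi y', ξ⟫_ℝ, hsup, fun q s' hq hs' => ?_⟩
  set d := q - y' with hd
  have hcs : ∀ i (l : Fin (k i)), ⟪Primal.om p i l, Dual.u d i l.castSucc⟫_ℝ
      - (θ i)⁻¹ * ⟪Dual.u (y' - y) i l.castSucc, Dual.u d i l.castSucc⟫_ℝ ≤ 0 := by
    intro i l
    have h1 := (h.u_init i l).inner_le_zero (P.convex_U i l.castSucc) (hq i l.castSucc)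
    have h2 : Dual.u y i l.castSucc + θ i • Primal.om p i l - Dual.u y' i l.castSucc
        = θ i • (Primal.om p i l - (θ i)⁻¹ • Dual.u (y' - y) i l.castSucc) := by
      rw [smul_sub, smul_smul, mul_inv_cancel₀ (hθ i).ne', one_smul, Dual.u_sub]
      abel
    rw [h2, real_inner_smul_left, inner_sub_left, real_inner_smul_left] at h1
    exact nonpos_of_mul_nonpos_right h1 (hθ i)
  have hlast : ∀ i, ⟪(P.Qt i).adjoint (Primal.x p) + P.qt i - ∑ l, Primal.om p i l,
      Dual.uLast d i⟫_ℝ - (θ i)⁻¹ * ⟪Dual.uLast (y' - y) i, Dual.uLast d i⟫_ℝ ≤ 0 := by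
    intro i
    have h1 := (h.u_last i).inner_le_zero (P.convex_U i (Fin.last _)) (hq i (Fin.last _))
    have h2 : Dual.uLast y i + θ i • ((P.Qt i).adjoint (Primal.x p) + P.qt i
          - ∑ l, Primal.om p i l) - Dual.uLast y' i
        = θ i • ((P.Qt i).adjoint (Primal.x p) + P.qt i - ∑ l, Primal.om p i l
          - (θ i)⁻¹ • Dual.uLast (y' - y) i) := by
      have h3 : Dual.uLast (y' - y) i = Dual.uLast y' i - Dual.uLast y i := rfl
      rw [smul_sub _ _ ((θ i)⁻¹ • _), smul_smul, mul_inv_cancel₀ (hθ i).ne', one_smul, h3]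
      abel
    rw [h2, real_inner_smul_left, inner_sub_left _ ((θ i)⁻¹ • _), real_inner_smul_left] at h1
    exact nonpos_of_mul_nonpos_right h1 (hθ i)
  have hw : ⟪P.A (Primal.x p) - P.b, Dual.w d⟫_ℝ
      - θw⁻¹ * ⟪Dual.w (y' - y), Dual.w d⟫_ℝ = 0 := by
    have h1 : Dual.w (y' - y) = θw • (P.A (Primal.x p) - P.b) := by
      rw [Dual.w_sub, h.w_eq, add_sub_cancel_left]
    rw [h1, real_inner_smul_left, ← mul_assoc,
      inv_mul_cancel₀ hθw.ne', one_mul, sub_self]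
  have hπ : ⟪Primal.x p, Dual.pi d⟫_ℝ - θπ⁻¹ * ⟪Dual.pi (y' - y), Dual.pi d⟫_ℝ
      ≤ s' - ⟪Dual.pi y', ξ⟫_ℝ := by
    have h1 : Dual.pi (y' - y) = θπ • (Primal.x p - ξ) := by
      rw [Dual.pi_sub, hpi, smul_sub]
      abel
    rw [h1, real_inner_smul_left, ← mul_assoc, inv_mul_cancel₀ hθπ.ne', one_mul, ← inner_sub_left,
      sub_sub_cancel, hd, Dual.pi_sub, inner_sub_right, real_inner_comm, real_inner_comm _ ξ]
    exact sub_le_sub_right (hs' ξ hξ) _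
  have hsum : ∑ i, (∑ l : Fin (k i), (⟪Primal.om p i l, Dual.u d i l.castSucc⟫_ℝ
      - (θ i)⁻¹ * ⟪Dual.u (y' - y) i l.castSucc, Dual.u d i l.castSucc⟫_ℝ)
      + (⟪(P.Qt i).adjoint (Primal.x p) + P.qt i - ∑ l, Primal.om p i l,
      Dual.uLast d i⟫_ℝ - (θ i)⁻¹ * ⟪Dual.uLast (y' - y) i, Dual.uLast d i⟫_ℝ)) ≤ 0 :=
    Finset.sum_nonpos fun i _ =>
      add_nonpos (Finset.sum_nonpos fun l _ => hcs i l) (hlast i)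
  have e : ⟪p, P.Qbar d⟫_ℝ + ⟪P.offsetVec, d⟫_ℝ - ⟪Sop θ θw θπ (y' - y), d⟫_ℝ
      = ∑ i, (∑ l : Fin (k i), (⟪Primal.om p i l, Dual.u d i l.castSucc⟫_ℝ
      - (θ i)⁻¹ * ⟪Dual.u (y' - y) i l.castSucc, Dual.u d i l.castSucc⟫_ℝ)
      + (⟪(P.Qt i).adjoint (Primal.x p) + P.qt i - ∑ l, Primal.om p i l,
      Dual.uLast d i⟫_ℝ - (θ i)⁻¹ * ⟪Dual.uLast (y' - y) i, Dual.uLast d i⟫_ℝ))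
      + (⟪P.A (Primal.x p) - P.b, Dual.w d⟫_ℝ - θw⁻¹ * ⟪Dual.w (y' - y), Dual.w d⟫_ℝ)
      + (⟪Primal.x p, Dual.pi d⟫_ℝ - θπ⁻¹ * ⟪Dual.pi (y' - y), Dual.pi d⟫_ℝ) := by
    rw [inner_offsetVec, inner_Sop, Primal.inner_eq, Qbar_apply]
    simp only [Primal.x_mk, Primal.om_mk, inner_add_right, inner_sub_left, inner_add_left,
      inner_sum, sum_inner, inner_sub_right, ContinuousLinearMap.adjoint_inner_right,
      ContinuousLinearMap.adjoint_inner_left, Fin.sum_univ_castSucc, Finset.sum_add_distrib,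
      Finset.sum_sub_distrib]
    simp only [Dual.uLast]
    ring
  rw [e]
  linarith

theorem IsPAPC.exists_gap_bound {τ : ℝ} {θ : Fin m → ℝ} {θw θπ : ℝ} (hτ : 0 < τ)
    (hθ : ∀ i, 0 < θ i) (hθw : 0 < θw) (hθπ : 0 < θπ) (hne : P.X.Nonempty)
    (hH : (P.Hop τ θ θw θπ).IsPositive) {χ : ℕ → Primal n dim k} {y : ℕ → Dual n r dim k}
    (h : P.IsPAPC τ θ θw θπ χ y) {N : ℕ} (hN : 1 ≤ N) :
    (∀ i l, Dual.u (ergodic y N) i l ∈ P.U i l) ∧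
    ∃ s : ℝ, (∀ x ∈ P.X, ⟪Dual.pi (ergodic y N), x⟫_ℝ ≤ s) ∧
      ∀ (χ' : Primal n dim k) (y' : Dual n r dim k) (s' : ℝ),
        (∀ i l, Dual.u y' i l ∈ P.U i l) → (∀ x ∈ P.X, ⟪Dual.pi y', x⟫_ℝ ≤ s') →
        (P.coupling (ergodic χ N) y' - s') - (P.coupling χ' (ergodic y N) - s)
          ≤ (τ⁻¹ * ‖χ' - χ 0‖ ^ 2 + sqNormOf (P.Hop τ θ θw θπ) (y' - y 0)) / (2 * N) := by
  have hN0 : (0 : ℝ) < N := by positivity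
  have hmem : ∀ j i l, Dual.u (y (j + 1)) i l ∈ P.U i l := fun j i l => by
    refine Fin.lastCases ?_ (fun l => ?_) l
    · exact ((h.dual_step j).u_last i).1
    · exact ((h.dual_step j).u_init i l).1
  choose s hs1 hs2 using fun j => (h.dual_step j).inner_le hθ hθw hθπ hne
  have hreidx : ∀ F : ℕ → ℝ, ∑ j ∈ Finset.Icc 1 N, F j = ∑ j ∈ Finset.range N, F (j + 1) :=
    fun F => by
      rw [Finset.range_eq_Ico, Finset.sum_Ico_add' F 0 N 1, zero_add]
      rfl
  refine ⟨fun i l => ?_, 1 / (N : ℝ) * ∑ j ∈ Finset.range N, s j, fun x hx => ?_,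
    fun χ' y' s' hy' hs' => ?_⟩
  · rw [Dual.u_ergodic]
    refine (P.convex_U i l).sum_mem (fun j _ => by positivity) ?_ fun j hj => ?_
    · rw [Finset.sum_const, Nat.card_Icc, add_tsub_cancel_right, nsmul_eq_mul]
      field_simp
    · obtain ⟨j, rfl⟩ := Nat.exists_eq_add_of_le' (Finset.mem_Icc.1 hj).1
      exact hmem j i l
  · rw [Dual.pi_ergodic, real_inner_smul_left, sum_inner, hreidx]
    gcongr with j
    exact hs1 j x hx
  · set H := P.Hop τ θ θw θπ with hHdef
    have step : ∀ j, (P.coupling (χ (j + 1)) y' - s') - (P.coupling χ' (y (j + 1)) - s j)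
        ≤ (τ⁻¹ * ‖χ' - χ j‖ ^ 2 + sqNormOf H (y' - y j)) / 2
          - (τ⁻¹ * ‖χ' - χ (j + 1)‖ ^ 2 + sqNormOf H (y' - y (j + 1))) / 2 := by
      intro j
      have h1 := hs2 j y' s' hy' hs'
      have hc := h.corrector j
      rw [primalStep_eq] at hc
      -- The predictor differs from the corrector by τ Q̄ applied to the dual increment; this
      -- correction turns S into H in `h3`.
      have hp : P.primalStep τ (χ j) (y j) = χ (j + 1) + τ • P.Qbar (y (j + 1) - y j) := by
        rw [primalStep_eq, hc, map_sub, smul_add, smul_add, smul_sub]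
        abel
      rw [hp, inner_add_left, real_inner_smul_left] at h1
      have h2 := real_inner_apply_sub_le_of_isPositive hH (y (j + 1)) (y j) y'
      have h3 : ⟪H (y (j + 1) - y j), y' - y (j + 1)⟫_ℝ
          = ⟪Sop θ θw θπ (y (j + 1) - y j), y' - y (j + 1)⟫_ℝ
            - τ * ⟪P.Qbar (y (j + 1) - y j), P.Qbar (y' - y (j + 1))⟫_ℝ := by
        rw [← ContinuousLinearMap.adjoint_inner_left, ← real_inner_smul_left, ← inner_sub_left]
        rfl
      have h4 : P.coupling (χ (j + 1)) y' - P.coupling χ' (y (j + 1))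
          = ⟪χ (j + 1), P.Qbar (y' - y (j + 1))⟫_ℝ + ⟪P.offsetVec, y' - y (j + 1)⟫_ℝ
            + ⟪χ (j + 1) - χ', P.costVec + P.Qbar (y (j + 1))⟫_ℝ := by
        rw [coupling_eq, coupling_eq]
        simp only [map_sub, inner_sub_left, inner_sub_right, inner_add_right]
        ring
      have h5 : P.costVec + P.Qbar (y (j + 1)) = τ⁻¹ • (χ j - χ (j + 1)) := by
        rw [hc, sub_sub_cancel, smul_smul, inv_mul_cancel₀ hτ.ne', one_smul]
      have h6 : ⟪χ (j + 1) - χ', χ j - χ (j + 1)⟫_ℝ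
          ≤ ‖χ' - χ j‖ ^ 2 / 2 - ‖χ' - χ (j + 1)‖ ^ 2 / 2 := by
        have e1 : χ' - χ j = (χ' - χ (j + 1)) - (χ j - χ (j + 1)) := by abel
        have e2 : χ (j + 1) - χ' = -(χ' - χ (j + 1)) := by abel
        rw [e1, norm_sub_sq_real, e2, inner_neg_left]
        nlinarith [sq_nonneg ‖χ j - χ (j + 1)‖]
      have h7 := mul_le_mul_of_nonneg_left h6 (inv_nonneg.2 hτ.le)
      rw [h5, real_inner_smul_right] at h4
      nlinarith
    have hnn : 0 ≤ (τ⁻¹ * ‖χ' - χ N‖ ^ 2 + sqNormOf H (y' - y N)) / 2 := by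
      have : 0 ≤ sqNormOf H (y' - y N) := hH.inner_nonneg_right _
      positivity
    have htot := Finset.sum_le_sum fun j (_ : j ∈ Finset.range N) => step j
    rw [Finset.sum_range_sub'
      (fun j => (τ⁻¹ * ‖χ' - χ j‖ ^ 2 + sqNormOf H (y' - y j)) / 2)] at htot
    rw [P.coupling_ergodic_left χ hN, P.coupling_ergodic_right χ' hN, hreidx, hreidx]
    simp only [Finset.sum_sub_distrib, Finset.sum_const, Finset.card_range, nsmul_eq_mul] at htot
    rw [le_div_iff₀ (by positivity)]
    refine le_trans (le_of_eq ?_) (by linarith : 2 * (∑ x ∈ Finset.range N,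
      P.coupling (χ (x + 1)) y' - ↑N * s' - (∑ x ∈ Finset.range N, P.coupling χ' (y (x + 1))
      - ∑ x ∈ Finset.range N, s x)) ≤ _)
    field_simp

theorem IsPAPC.saddleFn_ergodic_sub_le {τ : ℝ} {θ : Fin m → ℝ} {θw θπ : ℝ} (hτ : 0 < τ)
    (hθ : ∀ i, 0 < θ i) (hθw : 0 < θw) (hθπ : 0 < θπ) (hne : P.X.Nonempty)
    (hH : (P.Hop τ θ θw θπ).IsPositive) {χ : ℕ → Primal n dim k} {y : ℕ → Dual n r dim k}
    (h : P.IsPAPC τ θ θw θπ χ y) {N : ℕ} (hN : 1 ≤ N) (χ' : Primal n dim k)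
    (y' : Dual n r dim k) :
    P.saddleFn (ergodic χ N) y' - P.saddleFn χ' (ergodic y N)
      ≤ (((τ⁻¹ * ‖χ' - χ 0‖ ^ 2 + sqNormOf (P.Hop τ θ θw θπ) (y' - y 0)) / (2 * N) : ℝ)
        : EReal) := by
  obtain ⟨hmem, s, hs, hgap⟩ := h.exists_gap_bound hτ hθ hθw hθπ hne hH hN
  obtain ⟨x₀, hx₀⟩ := hne
  by_cases hy' : ∀ i l, Dual.u y' i l ∈ P.U i l
  · have e1 : P.saddleFn (ergodic χ N) y'
        = (P.coupling (ergodic χ N) y' : EReal) - supportFn P.X (Dual.pi y') := if_pos hy'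
    have e2 : P.saddleFn χ' (ergodic y N)
        = (P.coupling χ' (ergodic y N) : EReal) - supportFn P.X (Dual.pi (ergodic y N)) :=
      if_pos hmem
    have h2 : ((P.coupling χ' (ergodic y N) - s : ℝ) : EReal) ≤ P.saddleFn χ' (ergodic y N) := by
      rw [e2, EReal.coe_sub]
      exact EReal.sub_le_sub le_rfl (iSup₂_le fun x hx => EReal.coe_le_coe_iff.2 (hs x hx))
    have hbot : supportFn P.X (Dual.pi y') ≠ ⊥ :=
      ne_bot_of_le_ne_bot (EReal.coe_ne_bot ⟪Dual.pi y', x₀⟫_ℝ) (le_iSup₂_of_le x₀ hx₀ le_rfl)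
    by_cases htop : supportFn P.X (Dual.pi y') = ⊤
    · rw [e1, htop, EReal.sub_top, EReal.bot_sub]
      exact bot_le
    · obtain ⟨s', hs'⟩ : ∃ s' : ℝ, supportFn P.X (Dual.pi y') = s' :=
        ⟨_, (EReal.coe_toReal htop hbot).symm⟩
      refine (EReal.sub_le_sub le_rfl h2).trans ?_
      rw [e1, hs', ← EReal.coe_sub, ← EReal.coe_sub, EReal.coe_le_coe_iff]
      refine hgap χ' y' s' hy' fun x hx => EReal.coe_le_coe_iff.1 ?_
      rw [← hs']
      exact le_iSup₂_of_le x hx le_rfl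
  -- Outside the cones, as for an infinite support value above, the minuend is ⊥, and ⊥ minus
  -- anything is ⊥ in `EReal`.
  · have e1 : P.saddleFn (ergodic χ N) y' = ⊥ := if_neg hy'
    rw [e1, EReal.bot_sub]
    exact bot_le

end Problem

end RobustPAPC

/-! ### The constraint functions and the Lagrangian. -/

namespace RobustPAPC

theorem norm_le_radius {d : ℕ} {C : Set (Vec d)} (hC : IsCompact C) {z : Vec d} (hz : z ∈ C) :
    ‖z‖ ≤ radius C :=
  le_csSup (hC.image continuous_norm).bddAbove ⟨z, hz, rfl⟩

theorem radius_nonneg {d : ℕ} (C : Set (Vec d)) : 0 ≤ radius C :=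
  Real.sSup_nonneg (by rintro _ ⟨z, _, rfl⟩; positivity)

namespace Problem

variable {n r m : ℕ} {dim k : Fin m → ℕ} (P : Problem n r m dim k)

theorem sig_pos (i : Fin m) : 0 < P.sig i :=
  Finset.sum_pos (fun l _ => by positivity) Finset.univ_nonempty

theorem isCompact_Zcap (i : Fin m) : IsCompact (P.Zcap i) :=
  (P.Z_compact i 0).of_isClosed_subset (isClosed_iInter fun l => (P.Z_compact i l).isClosed)
    (Set.iInter_subset _ 0)

theorem continuous_g (i : Fin m) (x : Vec n) : Continuous fun z => P.g i x z := by
  unfold g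
  fun_prop

variable {P}

theorem g_le_f {i : Fin m} {z : Vec (dim i)} (hz : z ∈ P.Zcap i) (x : Vec n) :
    P.g i x z ≤ P.f i x :=
  le_csSup ((P.isCompact_Zcap i).image (P.continuous_g i x)).bddAbove ⟨z, hz, rfl⟩

theorem exists_f_eq_g {i : Fin m} (hZ : (P.Zcap i).Nonempty) (x : Vec n) :
    ∃ z ∈ P.Zcap i, P.f i x = P.g i x z :=
  (P.isCompact_Zcap i).exists_sSup_image_eq hZ (P.continuous_g i x).continuousOn

theorem inner_Qt_mkLift (i : Fin m) (x : Vec n) (z : Vec (dim i)) (t : ℝ) :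
    ⟪x, P.Qt i (mkLift (t • z) t)⟫_ℝ + ⟪P.qt i, mkLift (t • z) t⟫_ℝ = t * P.g i x z := by
  have h1 : P.Qt i (mkLift (t • z) t) = t • P.Q i z + t • P.dvec i := by
    rw [← map_smul]
    rfl
  rw [h1, lift_inner]
  simp only [qt, mkLift, inner_add_right, real_inner_smul_right, g, WithLp.toLp_fst, WithLp.toLp_snd]
  rw [real_inner_comm x (P.dvec i)]
  ring

/-- A maximiser z for x is tested at x'. The lifted vector (z, 1) has norm at most R_{i,s_i} + 1,
which is the factor appearing in R_π. -/
theorem f_le_add {i : Fin m} (hZ : (P.Zcap i).Nonempty) (x x' : Vec n) :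
    P.f i x ≤ P.f i x' + ‖P.Qt i‖ * (radius (P.Z i (Fin.last (k i))) + 1) * ‖x - x'‖ := by
  obtain ⟨z, hz, hzf⟩ := P.exists_f_eq_g hZ x
  have h1 := P.inner_Qt_mkLift i x z 1
  have h2 := P.inner_Qt_mkLift i x' z 1
  rw [one_smul, one_mul] at h1 h2
  have h3 : ⟪x - x', P.Qt i (mkLift z 1)⟫_ℝ
      ≤ ‖x - x'‖ * (‖P.Qt i‖ * (radius (P.Z i (Fin.last (k i))) + 1)) := by
    refine (real_inner_le_norm _ _).trans ?_
    gcongr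
    refine ((P.Qt i).le_opNorm _).trans ?_
    gcongr
    have h4 : ‖z‖ ≤ radius (P.Z i (Fin.last (k i))) :=
      norm_le_radius (P.Z_compact i _) (Set.mem_iInter.1 hz _)
    refine abs_le_of_sq_le_sq' ?_ (by linarith [norm_nonneg z]) |>.2
    rw [lift_norm_sq]
    simp only [mkLift, WithLp.toLp_fst, WithLp.toLp_snd]
    nlinarith [norm_nonneg z]
  have h5 := P.g_le_f hz x'
  rw [inner_sub_left] at h3
  linarith

theorem continuous_f {i : Fin m} (hZ : (P.Zcap i).Nonempty) : Continuous (P.f i) := by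
  have hK : 0 ≤ ‖P.Qt i‖ * (radius (P.Z i (Fin.last (k i))) + 1) := by
    have := radius_nonneg (P.Z i (Fin.last (k i)))
    positivity
  refine (LipschitzWith.of_le_add_mul ⟨_, hK⟩ fun x x' => ?_).continuous
  rw [dist_eq_norm]
  exact P.f_le_add hZ x x'

theorem convexOn_f {i : Fin m} (hZ : (P.Zcap i).Nonempty) : ConvexOn ℝ Set.univ (P.f i) := by
  refine ⟨convex_univ, fun x _ x' _ s t hs ht hst => ?_⟩
  obtain ⟨z, hz, hzf⟩ := P.exists_f_eq_g hZ (s • x + t • x')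
  have h1 := mul_le_mul_of_nonneg_left (P.g_le_f hz x) hs
  have h2 := mul_le_mul_of_nonneg_left (P.g_le_f hz x') ht
  rw [hzf, smul_eq_mul, smul_eq_mul]
  refine le_trans (le_of_eq ?_) (add_le_add h1 h2)
  simp only [g, inner_add_left, inner_add_right, real_inner_smul_left, real_inner_smul_right]
  linear_combination -(⟪P.q i, z⟫_ℝ + P.gam i) * hst

theorem lagrangian_le_of_feasible {x : Vec n} (hx : P.IsFeasible x) {lam : Fin m → ℝ}
    (hlam : ∀ i, 0 ≤ lam i) (w : Vec r) : P.lagrangian x lam w ≤ ⟪P.c, x⟫_ℝ := by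
  rw [lagrangian, hx.2.1, sub_self, inner_zero_right, add_zero]
  have : ∑ i, lam i * P.f i x ≤ 0 :=
    Finset.sum_nonpos fun i _ => mul_nonpos_of_nonneg_of_nonpos (hlam i) (hx.2.2 i)
  linarith

/-- Lagrange multipliers certifying that `⟨c, x⟩` is a lower bound for the Lagrangian. -/
def IsMultiplier (P : Problem n r m dim k) (x : Vec n) (lam : Fin m → ℝ) (w : Vec r) : Prop :=
  (∀ i, 0 ≤ lam i) ∧ ∀ x' ∈ P.X, ⟪P.c, x⟫_ℝ ≤ P.lagrangian x' lam w

theorem IsMultiplier.lagrangian_eq {x : Vec n} {lam : Fin m → ℝ} {w : Vec r}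
    (h : P.IsMultiplier x lam w) (hx : P.IsFeasible x) :
    P.lagrangian x lam w = ⟪P.c, x⟫_ℝ :=
  le_antisymm (lagrangian_le_of_feasible hx h.1 w) (h.2 x hx.1)

theorem surjective_of_finrank_range
    (hrank : Module.finrank ℝ (LinearMap.range P.A.toLinearMap) = r) : Function.Surjective P.A := by
  have : LinearMap.range P.A.toLinearMap = ⊤ :=
    Submodule.eq_top_of_finrank_eq (by rw [hrank, finrank_euclideanSpace_fin])
  exact LinearMap.range_eq_top.1 this

theorem IsSlater.isFeasible {xhat : Vec n} {e : ℝ} (h : P.IsSlater xhat e) :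
    P.IsFeasible xhat := by
  have := h.2.2.2 0 (by simpa using h.2.2.1.le)
  rw [add_zero] at this
  exact ⟨this.1, h.2.1, fun i => (this.2 i).le⟩

theorem IsSlater.f_neg {xhat : Vec n} {e : ℝ} (h : P.IsSlater xhat e) (i : Fin m) :
    P.f i xhat < 0 := by
  have := h.2.2.2 0 (by simpa using h.2.2.1.le)
  rw [add_zero] at this
  exact this.2 i

/-! ### Existence of Lagrange multipliers by separation. -/

theorem nonneg_of_forall_pos_add_mul {a b : ℝ} (h : ∀ M : ℝ, 0 ≤ M → 0 < a + b * M) : 0 ≤ b := by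
  by_contra hb
  push Not at hb
  have h1 := h 0 le_rfl
  have h2 := h (a / -b) (div_nonneg (by linarith) (by linarith))
  have : b * (a / -b) = -a := by rw [div_neg, mul_neg, mul_div_cancel₀ _ hb.ne]
  linarith

theorem nonneg_of_forall_pos_mul_add {a b : ℝ} (h : ∀ δ : ℝ, 0 < δ → 0 < a + b * δ) : 0 ≤ a := by
  by_contra ha
  push Not at ha
  have hb : 0 < |b| + 1 := by positivity
  have h1 := h (-a / (|b| + 1)) (div_pos (by linarith) hb)
  have h2 : b * (-a / (|b| + 1)) ≤ (|b| + 1) * (-a / (|b| + 1)) :=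
    mul_le_mul_of_nonneg_right (by linarith [le_abs_self b]) (div_nonneg (by linarith) hb.le)
  rw [mul_div_cancel₀ _ hb.ne'] at h2
  linarith

/-- A linear right inverse of A moves x so as to produce any nearby residual, and the remaining
conditions are strict. Openness allows separation from 0 with a strict inequality. -/
theorem isOpen_perturbation_set (hrank : Module.finrank ℝ (LinearMap.range P.A.toLinearMap) = r)
    (hZ : ∀ i, (P.Zcap i).Nonempty) (v : ℝ) :
    IsOpen {q : ℝ × (Fin m → ℝ) × Vec r | ∃ x ∈ interior P.X, ⟪P.c, x⟫_ℝ - v < q.1 ∧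
      (∀ i, P.f i x < q.2.1 i) ∧ P.A x - P.b = q.2.2} := by
  obtain ⟨B, hB⟩ := P.A.toLinearMap.exists_rightInverse_of_surjective
    (LinearMap.range_eq_top.2 (surjective_of_finrank_range hrank))
  have hAB : ∀ p, P.A (B p) = p := fun p => LinearMap.congr_fun hB p
  have hBc : Continuous B := B.continuous_of_finiteDimensional
  refine isOpen_iff_forall_mem_open.2 ?_
  rintro q ⟨x, hx, h1, h2, h3⟩
  let ξ : ℝ × (Fin m → ℝ) × Vec r → Vec n := fun q' => x + B (q'.2.2 - (P.A x - P.b))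
  have hξ : Continuous ξ := by fun_prop
  have hξq : ξ q = x := by simp [ξ, h3]
  refine ⟨{q' | ξ q' ∈ interior P.X ∧ ⟪P.c, ξ q'⟫_ℝ - v < q'.1 ∧ ∀ i, P.f i (ξ q') < q'.2.1 i},
    ?_, ?_, ?_⟩
  · rintro q' ⟨g1, g2, g3⟩
    refine ⟨ξ q', g1, g2, g3, ?_⟩
    simp only [ξ, map_add, hAB]
    abel
  · have o1 : IsOpen {q' : ℝ × (Fin m → ℝ) × Vec r | ⟪P.c, ξ q'⟫_ℝ - v < q'.1} :=
      isOpen_lt (by fun_prop) (by fun_prop)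
    have o2 : IsOpen {q' : ℝ × (Fin m → ℝ) × Vec r | ∀ i, P.f i (ξ q') < q'.2.1 i} := by
      simp only [Set.ofPred_forall]
      exact isOpen_iInter_of_finite fun i =>
        isOpen_lt ((continuous_f (hZ i)).comp hξ) (by fun_prop)
    exact (isOpen_interior.preimage hξ).inter (o1.inter o2)
  · simp only [Set.mem_ofPred_eq, hξq]
    exact ⟨hx, h1, h2⟩

theorem convex_perturbation_set (hZ : ∀ i, (P.Zcap i).Nonempty) (v : ℝ) :
    Convex ℝ {q : ℝ × (Fin m → ℝ) × Vec r | ∃ x ∈ interior P.X, ⟪P.c, x⟫_ℝ - v < q.1 ∧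
      (∀ i, P.f i x < q.2.1 i) ∧ P.A x - P.b = q.2.2} := by
  refine convex_iff_forall_pos.2 ?_
  rintro q ⟨x, hx, h1, h2, h3⟩ q' ⟨x', hx', h1', h2', h3'⟩ s t hs ht hst
  refine ⟨s • x + t • x', P.X_convex.interior hx hx' hs.le ht.le hst, ?_, fun i => ?_, ?_⟩
  · simp only [inner_add_right, real_inner_smul_right, Prod.fst_add, Prod.smul_fst, smul_eq_mul]
    have e : v = s * v + t * v := by rw [← add_mul, hst, one_mul]
    have := mul_lt_mul_of_pos_left h1 hs
    have := mul_lt_mul_of_pos_left h1' ht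
    linarith
  · refine ((convexOn_f (hZ i)).2 trivial trivial hs.le ht.le hst).trans_lt ?_
    exact add_lt_add (mul_lt_mul_of_pos_left (h2 i) hs) (mul_lt_mul_of_pos_left (h2' i) ht)
  · simp only [map_add, map_smul, Prod.snd_add, Prod.smul_snd, ← h3, ← h3', smul_sub]
    have e : P.b = s • P.b + t • P.b := by rw [← add_smul, hst, one_smul]
    nth_rewrite 1 [e]
    abel

/-- Optimality keeps 0 out of the perturbation set, and the coefficients (ρ, ν, w) of a separating
functional, divided by ρ, are the multipliers. The inequality is first obtained on the interior of X
and extended to X by continuity. -/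
theorem IsOptimal.exists_isMultiplier {xs xhat : Vec n} {e : ℝ} (hxs : P.IsOptimal xs)
    (hslater : P.IsSlater xhat e)
    (hrank : Module.finrank ℝ (LinearMap.range P.A.toLinearMap) = r)
    (hZ : ∀ i, (P.Zcap i).Nonempty) : ∃ lam w, P.IsMultiplier xs lam w := by
  obtain ⟨φ, hφ⟩ := geometric_hahn_banach_point_open (x := (0 : ℝ × (Fin m → ℝ) × Vec r))
    (convex_perturbation_set hZ ⟪P.c, xs⟫_ℝ) (isOpen_perturbation_set hrank hZ ⟪P.c, xs⟫_ℝ) (by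
      rintro ⟨x, hx, h1, h2, h3⟩
      have := hxs.2 x ⟨interior_subset hx, sub_eq_zero.1 h3, fun i => (h2 i).le⟩
      simp only [Prod.fst_zero] at h1
      linarith)
  set ρ : ℝ := φ (1, 0, 0)
  set ν : Fin m → ℝ := fun i => φ (0, Pi.single i 1, 0)
  set w : Vec r := (InnerProductSpace.toDual ℝ (Vec r)).symm
    (φ ∘L ContinuousLinearMap.inr ℝ ℝ _ ∘L ContinuousLinearMap.inr ℝ (Fin m → ℝ) (Vec r))
  have hw : ∀ p, φ (0, 0, p) = ⟪w, p⟫_ℝ := fun p => by simp [w]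
  have hφe : ∀ s t p, φ (s, t, p) = ρ * s + ∑ i, ν i * t i + ⟪w, p⟫_ℝ := by
    intro s t p
    have e1 : (s, t, p) = s • ((1, 0, 0) : ℝ × (Fin m → ℝ) × Vec r)
        + ∑ i, t i • ((0, Pi.single i 1, 0) : ℝ × (Fin m → ℝ) × Vec r) + (0, 0, p) := by
      refine Prod.ext ?_ (Prod.ext ?_ ?_)
      · simp [Prod.fst_sum]
      · ext j
        simp [Prod.fst_sum, Prod.snd_sum, Finset.sum_apply, Pi.single_apply]
      · simp [Prod.snd_sum]
    rw [e1, map_add, map_add, map_smul, map_sum, hw]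
    simp only [map_smul, smul_eq_mul, ρ, ν]
    congr 2
    · ring
    · exact Finset.sum_congr rfl fun i _ => mul_comm _ _
  have key : ∀ x ∈ interior P.X, ∀ (s : ℝ) (t : Fin m → ℝ), ⟪P.c, x⟫_ℝ - ⟪P.c, xs⟫_ℝ < s →
      (∀ i, P.f i x < t i) → 0 < ρ * s + ∑ i, ν i * t i + ⟪w, P.A x - P.b⟫_ℝ := by
    intro x hx s t h1 h2
    have := hφ (s, t, P.A x - P.b) ⟨x, hx, h1, h2, rfl⟩
    rwa [map_zero, hφe] at this
  have hxh := hslater.1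
  have hAx : P.A xhat - P.b = 0 := sub_eq_zero.2 hslater.2.1
  have hρ0 : 0 ≤ ρ := by
    refine nonneg_of_forall_pos_add_mul (a := ρ * (⟪P.c, xhat⟫_ℝ - ⟪P.c, xs⟫_ℝ + 1)
      + ∑ i, ν i * (P.f i xhat + 1)) fun M hM => ?_
    have := key xhat hxh (⟪P.c, xhat⟫_ℝ - ⟪P.c, xs⟫_ℝ + 1 + M) (fun i => P.f i xhat + 1)
      (by linarith) (fun i => by linarith)
    rw [hAx, inner_zero_right] at this
    linarith
  have hν0 : ∀ j, 0 ≤ ν j := by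
    intro j
    refine nonneg_of_forall_pos_add_mul (a := ρ * (⟪P.c, xhat⟫_ℝ - ⟪P.c, xs⟫_ℝ + 1)
      + ∑ i, ν i * (P.f i xhat + 1)) fun M hM => ?_
    have := key xhat hxh (⟪P.c, xhat⟫_ℝ - ⟪P.c, xs⟫_ℝ + 1)
      (fun i => P.f i xhat + 1 + Pi.single (M := fun _ => ℝ) j M i)
      (by linarith) (fun i => by
        have : 0 ≤ Pi.single (M := fun _ => ℝ) j M i := by
          by_cases hij : i = j
          · subst hij; simpa using hM
          · simp [hij]
        linarith)
    rw [hAx, inner_zero_right] at this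
    simp only [mul_add, Finset.sum_add_distrib, Pi.single_apply, mul_ite, mul_zero,
      Finset.sum_ite_eq', Finset.mem_univ, if_true] at this ⊢
    linarith
  -- If ρ were 0, the levels f_i(x̂)/2, which lie strictly above f_i(x̂) but are still negative,
  -- would give a nonpositive value.
  have hρ : 0 < ρ := by
    refine lt_of_le_of_ne hρ0 fun h => ?_
    have := key xhat hxh (⟪P.c, xhat⟫_ℝ - ⟪P.c, xs⟫_ℝ + 1) (fun i => P.f i xhat / 2)
      (by linarith) (fun i => by linarith [hslater.f_neg i])
    rw [hAx, inner_zero_right, ← h] at this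
    have h2 : ∑ i, ν i * (P.f i xhat / 2) ≤ 0 := Finset.sum_nonpos fun i _ =>
      mul_nonpos_of_nonneg_of_nonpos (hν0 i) (by linarith [hslater.f_neg i])
    linarith
  refine ⟨fun i => ν i / ρ, ρ⁻¹ • w, fun i => div_nonneg (hν0 i) hρ.le, fun x hx => ?_⟩
  have hclosed : IsClosed {x : Vec n | 0 ≤ ρ * (⟪P.c, x⟫_ℝ - ⟪P.c, xs⟫_ℝ) + ∑ i, ν i * P.f i x
      + ⟪w, P.A x - P.b⟫_ℝ} := by
    have := fun i => continuous_f (hZ i)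
    exact isClosed_le continuous_const (by fun_prop)
  have hint : interior P.X ⊆ {x : Vec n | 0 ≤ ρ * (⟪P.c, x⟫_ℝ - ⟪P.c, xs⟫_ℝ)
      + ∑ i, ν i * P.f i x + ⟪w, P.A x - P.b⟫_ℝ} := by
    intro x hx
    refine nonneg_of_forall_pos_mul_add (b := ρ + ∑ i, ν i) fun δ hδ => ?_
    have := key x hx (⟪P.c, x⟫_ℝ - ⟪P.c, xs⟫_ℝ + δ) (fun i => P.f i x + δ)
      (by linarith) (fun i => by linarith)
    simp only [mul_add, Finset.sum_add_distrib, ← Finset.sum_mul] at this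
    linarith
  have hxc : x ∈ closure (interior P.X) := by
    rw [P.X_convex.closure_interior_eq_closure_of_nonempty_interior ⟨xhat, hxh⟩]
    exact subset_closure hx
  have h := closure_minimal hint hclosed hxc
  have h' := mul_nonneg (inv_nonneg.2 hρ.le) h
  have e1 : P.lagrangian x (fun i => ν i / ρ) (ρ⁻¹ • w) - ⟪P.c, xs⟫_ℝ
      = ρ⁻¹ * (ρ * (⟪P.c, x⟫_ℝ - ⟪P.c, xs⟫_ℝ) + ∑ i, ν i * P.f i x
      + ⟪w, P.A x - P.b⟫_ℝ) := by
    have e2 : ∑ i, ν i / ρ * P.f i x = ρ⁻¹ * ∑ i, ν i * P.f i x := by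
      rw [Finset.mul_sum]
      exact Finset.sum_congr rfl fun i _ => by ring
    rw [lagrangian, e2, real_inner_smul_left]
    field_simp
    ring
  linarith

/-- The existing multiplier has dual value at least cᵀx*, so a dual optimal pair has too. -/
theorem IsDualOptimal.isMultiplier {xs : Vec n} {lams : Fin m → ℝ} {ws : Vec r}
    (h : P.IsDualOptimal lams ws) (hex : ∃ lam w, P.IsMultiplier xs lam w) :
    P.IsMultiplier xs lams ws := by
  obtain ⟨lam, w, hlam, hm⟩ := hex
  refine ⟨h.1, fun x hx => EReal.coe_le_coe_iff.1 ?_⟩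
  calc ((⟪P.c, xs⟫_ℝ : ℝ) : EReal) ≤ P.dualFn lam w :=
        le_iInf₂ fun x' hx' => EReal.coe_le_coe_iff.2 (hm x' hx')
    _ ≤ P.dualFn lams ws := h.2 lam w hlam
    _ ≤ _ := iInf₂_le x hx

/-- Maximality in the multipliers is tested three times: shifting w by the residual forces Ax = b,
raising one λ_i by 1 forces f_i ≤ 0, and zero multipliers give cᵀx ≤ L. -/
theorem IsSaddle.isOptimal_and_isMultiplier {xs : Vec n} {lams : Fin m → ℝ} {ws : Vec r}
    (h : P.IsSaddle xs lams ws) : P.IsOptimal xs ∧ P.IsMultiplier xs lams ws := by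
  obtain ⟨hx, hlam, hmax, hmin⟩ := h
  have hA : P.A xs - P.b = 0 := by
    have := hmax lams (ws + (P.A xs - P.b)) hlam
    simp only [lagrangian, inner_add_left] at this
    exact real_inner_self_nonpos.1 (by linarith)
  have hf : ∀ i, P.f i xs ≤ 0 := fun i => by
    have := hmax (lams + Pi.single i 1) ws fun j => by
      have : 0 ≤ Pi.single (M := fun _ => ℝ) i 1 j := by
        by_cases hij : j = i
        · subst hij; simp
        · simp [hij]
      exact add_nonneg (hlam j) this
    simp only [lagrangian, Pi.add_apply, add_mul, Finset.sum_add_distrib, Pi.single_apply,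
      ite_mul, one_mul, zero_mul, Finset.sum_ite_eq', Finset.mem_univ, if_true] at this
    linarith
  have hfeas : P.IsFeasible xs := ⟨hx, sub_eq_zero.1 hA, hf⟩
  have hc : ⟪P.c, xs⟫_ℝ ≤ P.lagrangian xs lams ws := by
    have := hmax 0 0 fun i => le_rfl
    simpa [lagrangian] using this
  refine ⟨⟨hfeas, fun x' hx' => ?_⟩, hlam, fun x' hx' => hc.trans (hmin x' hx')⟩
  exact (hc.trans (hmin x' hx'.1)).trans (lagrangian_le_of_feasible hx' hlam ws)

/-! ### Explicit bounds on the multipliers. -/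

section Bounds

variable {xs xhat : Vec n} {e v : ℝ}

theorem lamBar_nonneg (hslater : P.IsSlater xhat e) (hv : v ≤ ⟪P.c, xhat⟫_ℝ) :
    0 ≤ P.lamBar xhat v := by
  refine div_nonneg (sub_nonneg.2 hv) (neg_nonneg.2 ?_)
  exact Real.iSup_nonpos fun i => (hslater.f_neg i).le

theorem Rw_nonneg (hslater : P.IsSlater xhat e) (hv : v ≤ ⟪P.c, xhat⟫_ℝ) :
    0 ≤ P.Rw xhat e v := by
  have h1 := P.A.toLinearMap.singularValues_nonneg (r - 1)
  have h2 := hslater.2.2.1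
  have h3 := sub_nonneg.2 hv
  unfold Rw sigmaMin
  positivity

theorem Rpi_nonneg (hslater : P.IsSlater xhat e) (hv : v ≤ ⟪P.c, xhat⟫_ℝ) :
    0 ≤ P.Rpi xhat e v := by
  have h1 := lamBar_nonneg hslater hv
  have h2 := Rw_nonneg hslater hv
  have h3 : ∀ i, 0 ≤ radius (P.Z i (Fin.last (k i))) := fun i => radius_nonneg _
  unfold Rpi
  have : 0 ≤ ∑ i, ‖P.Qt i‖ * (radius (P.Z i (Fin.last (k i))) + 1) :=
    Finset.sum_nonneg fun i _ => mul_nonneg (norm_nonneg _) (by linarith [h3 i])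
  positivity

/-- At x̂ every term λ_j f_j is nonpositive, so all but the i-th can be dropped. -/
theorem IsMultiplier.le_lamBar {lam : Fin m → ℝ} {w : Vec r} (h : P.IsMultiplier xs lam w)
    (hslater : P.IsSlater xhat e) (hv : v ≤ ⟪P.c, xs⟫_ℝ) (i : Fin m) :
    lam i ≤ P.lamBar xhat v := by
  have hne : Nonempty (Fin m) := ⟨i⟩
  obtain ⟨j, hj⟩ := exists_eq_ciSup_of_finite (f := fun i => P.f i xhat)
  have hM : (⨆ i, P.f i xhat) < 0 := hj ▸ hslater.f_neg j
  have h1 := h.2 xhat hslater.isFeasible.1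
  rw [lagrangian, hslater.2.1, sub_self, inner_zero_right, add_zero] at h1
  have h2 : ∑ j, lam j * P.f j xhat ≤ lam i * P.f i xhat := by
    rw [← Finset.add_sum_erase _ _ (Finset.mem_univ i)]
    have : ∑ j ∈ Finset.univ.erase i, lam j * P.f j xhat ≤ 0 := Finset.sum_nonpos fun j _ =>
      mul_nonpos_of_nonneg_of_nonpos (h.1 j) (hslater.f_neg j).le
    linarith
  have h3 : lam i * P.f i xhat ≤ lam i * ⨆ i, P.f i xhat :=
    mul_le_mul_of_nonneg_left (le_ciSup (f := fun i => P.f i xhat) (Set.finite_range _).bddAbove i)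
      (h.1 i)
  rw [lamBar, le_div_iff₀ (by linarith)]
  linarith

theorem IsMultiplier.norm_le_Rw {lam : Fin m → ℝ} {w : Vec r} (h : P.IsMultiplier xs lam w)
    (hslater : P.IsSlater xhat e)
    (hrank : Module.finrank ℝ (LinearMap.range P.A.toLinearMap) = r)
    (hv : v ≤ ⟪P.c, xs⟫_ℝ) (hv' : v ≤ ⟪P.c, xhat⟫_ℝ) : ‖w‖ ≤ P.Rw xhat e v := by
  have he := hslater.2.2.1
  -- The case w = 0 covers r = 0, where the smallest singular value need not be positive.
  rcases eq_or_ne w 0 with rfl | hw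
  · rw [norm_zero]
    exact Rw_nonneg hslater hv'
  have hr : 0 < r := by
    rcases Nat.eq_zero_or_pos r with rfl | hr
    · exact absurd (Subsingleton.elim w 0) hw
    · exact hr
  have hσ : 0 < P.sigmaMin :=
    P.A.toLinearMap.singularValues_pos_iff_lt_finrank_range.2 (by rw [hrank]; omega)
  obtain ⟨x, rfl⟩ := surjective_of_finrank_range hrank w
  have h1 : P.sigmaMin * ‖P.A x‖ ≤ ‖P.A.adjoint (P.A x)‖ :=
    singularValues_mul_norm_le_norm_adjoint P.A.toLinearMap hrank x
  set a := P.A.adjoint (P.A x) with ha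
  have h2 : ‖a‖ ≤ (⟪P.c, xhat⟫_ℝ - v) / e + ‖P.c‖ := by
    have hapos : 0 < ‖a‖ := lt_of_lt_of_le (mul_pos hσ (norm_pos_iff.2 hw)) h1
    -- The step from x̂ goes against Aᵀw with the full Slater margin, so the equality term becomes
    -- -e ‖Aᵀw‖ while the inequality terms stay nonpositive.
    set d : Vec n := -(e / ‖a‖) • a with hd
    have hdn : ‖d‖ = e := by
      rw [hd, norm_smul, norm_neg, Real.norm_of_nonneg (by positivity)]
      field_simp
    obtain ⟨g1, g2⟩ := hslater.2.2.2 d hdn.le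
    have h3 := h.2 _ g1
    have h4 : ⟪P.A x, P.A (xhat + d) - P.b⟫_ℝ = -(e * ‖a‖) := by
      rw [map_add, hslater.2.1, add_sub_cancel_left, ← ContinuousLinearMap.adjoint_inner_left, ← ha,
        hd, real_inner_smul_right, real_inner_self_eq_norm_sq]
      field_simp
    have h5 : ∑ i, lam i * P.f i (xhat + d) ≤ 0 := Finset.sum_nonpos fun i _ =>
      mul_nonpos_of_nonneg_of_nonpos (h.1 i) (g2 i).le
    have h6 : ⟪P.c, d⟫_ℝ ≤ ‖P.c‖ * e := hdn ▸ real_inner_le_norm P.c d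
    rw [lagrangian, h4, inner_add_right] at h3
    rw [div_add' _ _ _ he.ne', le_div_iff₀ he]
    linarith
  rw [Rw, one_div, ← div_eq_inv_mul, le_div_iff₀ hσ, mul_comm]
  exact h1.trans h2

/-- Compare x with its projection onto X, where the multiplier inequality holds: R_π is a Lipschitz
constant of the Lagrangian in x. -/
theorem IsMultiplier.le_lagrangian_add {lam : Fin m → ℝ} {w : Vec r}
    (h : P.IsMultiplier xs lam w) (hslater : P.IsSlater xhat e)
    (hrank : Module.finrank ℝ (LinearMap.range P.A.toLinearMap) = r)
    (hZ : ∀ i, (P.Zcap i).Nonempty)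
    (hv : v ≤ ⟪P.c, xs⟫_ℝ) (hv' : v ≤ ⟪P.c, xhat⟫_ℝ) (x : Vec n) :
    ⟪P.c, xs⟫_ℝ ≤ P.lagrangian x lam w + P.Rpi xhat e v * Metric.infDist x P.X := by
  obtain ⟨p, hp, hdist⟩ := P.X_closed.exists_infDist_eq_dist ⟨xhat, hslater.isFeasible.1⟩ x
  have h1 := h.2 p hp
  have hw := h.norm_le_Rw hslater hrank hv hv'
  rw [hdist, dist_comm, dist_eq_norm]
  have e1 : ⟪P.c, p⟫_ℝ - ⟪P.c, x⟫_ℝ ≤ ‖P.c‖ * ‖p - x‖ := by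
    rw [← inner_sub_right]
    exact real_inner_le_norm _ _
  have e2 : ⟪w, P.A p - P.b⟫_ℝ - ⟪w, P.A x - P.b⟫_ℝ ≤ ‖P.A‖ * P.Rw xhat e v * ‖p - x‖ := by
    rw [← inner_sub_right, sub_sub_sub_cancel_right, ← map_sub]
    calc ⟪w, P.A (p - x)⟫_ℝ ≤ ‖w‖ * ‖P.A (p - x)‖ := real_inner_le_norm _ _
      _ ≤ P.Rw xhat e v * (‖P.A‖ * ‖p - x‖) := by
        gcongr
        · exact (norm_nonneg _).trans hw
        · exact P.A.le_opNorm _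
      _ = _ := by ring
  have e3 : ∑ i, lam i * P.f i p - ∑ i, lam i * P.f i x
      ≤ P.lamBar xhat v * (∑ i, ‖P.Qt i‖ * (radius (P.Z i (Fin.last (k i))) + 1)) * ‖p - x‖ := by
    rw [← Finset.sum_sub_distrib, Finset.mul_sum, Finset.sum_mul]
    refine Finset.sum_le_sum fun i _ => ?_
    have hr := radius_nonneg (P.Z i (Fin.last (k i)))
    have g1 := mul_le_mul_of_nonneg_left (P.f_le_add (hZ i) p x) (h.1 i)
    have g2 : lam i * (‖P.Qt i‖ * (radius (P.Z i (Fin.last (k i))) + 1) * ‖p - x‖)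
        ≤ P.lamBar xhat v * (‖P.Qt i‖ * (radius (P.Z i (Fin.last (k i))) + 1) * ‖p - x‖) :=
      mul_le_mul_of_nonneg_right (h.le_lamBar hslater hv i) (by positivity)
    linarith
  rw [lagrangian] at h1 ⊢
  rw [Rpi]
  linarith

end Bounds

end Problem

end RobustPAPC

/-! ### Comparison points for the gap and the bound on the Lagrangian. -/

namespace RobustPAPC

variable {n r m : ℕ} {dim k : Fin m → ℕ} {P : Problem n r m dim k}

theorem norm_sub_sq_le_of_mem_OmegaSet {d : ℕ} {μ ε : ℝ} (hε : 0 < ε) {a b : Lift d}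
    (ha : a ∈ OmegaSet μ ε) (hb : b ∈ OmegaSet μ ε) :
    ‖a - b‖ ^ 2 ≤ 4 * μ ^ 2 * (1 + 1 / ε) ^ 2 := by
  obtain ⟨a1, a2, a3⟩ := ha
  obtain ⟨b1, b2, b3⟩ := hb
  have hμ : 0 ≤ μ := by linarith
  have h1 : ‖a.fst - b.fst‖ ≤ 2 * (μ / ε) := by
    have e1 : -a.snd / ε ≤ μ / ε := by gcongr; linarith
    have e2 : -b.snd / ε ≤ μ / ε := by gcongr; linarith
    linarith [norm_sub_le a.fst b.fst]
  have h2 : ‖a.fst - b.fst‖ ^ 2 ≤ (2 * (μ / ε)) ^ 2 := by gcongr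
  have h3 : (a.snd - b.snd) ^ 2 ≤ μ ^ 2 :=
    sq_le_sq' (by linarith) (by linarith)
  have h4 : 0 ≤ μ ^ 2 * (1 / ε) := by positivity
  rw [lift_norm_sq]
  change ‖a.fst - b.fst‖ ^ 2 + (a.snd - b.snd) ^ 2 ≤ _
  have e : 4 * μ ^ 2 * (1 + 1 / ε) ^ 2 = 4 * μ ^ 2 + 8 * (μ ^ 2 * (1 / ε)) + (2 * (μ / ε)) ^ 2 := by
    ring
  rw [e]
  nlinarith [sq_nonneg μ]

/-- As a/0 = 0, a vector can be rescaled to norm at most a without treating the zero vector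
separately. -/
theorem div_mul_self_le_of_nonneg {a : ℝ} (ha : 0 ≤ a) (b : ℝ) : a / b * b ≤ a := by
  rcases eq_or_ne b 0 with h | h
  · simpa [h] using ha
  · rw [div_mul_cancel₀ _ h]

/-- The scaled distance is the maximum of ⟨p, x⟩ - σ_X(p) over ‖p‖ ≤ α, attained along x minus its
projection; `s` is σ_X(p). -/
theorem exists_distance_certificate {X : Set (Vec n)} (hne : X.Nonempty) (hcl : IsClosed X)
    (hX : Convex ℝ X) {α : ℝ} (hα : 0 ≤ α) (x : Vec n) :
    ∃ (p : Vec n) (s : ℝ), ‖p‖ ≤ α ∧ (∀ z ∈ X, ⟪p, z⟫_ℝ ≤ s) ∧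
      ⟪x, p⟫_ℝ - s = α * Metric.infDist x X := by
  obtain ⟨q, hq, hdist⟩ := hcl.exists_infDist_eq_dist hne x
  have hproj : IsProjOn X x q := ⟨hq, fun z hz => by
    rw [← dist_eq_norm, dist_comm, ← hdist, ← dist_eq_norm, dist_comm z]
    exact Metric.infDist_le_dist_of_mem hz⟩
  refine ⟨(α / ‖x - q‖) • (x - q), ⟪(α / ‖x - q‖) • (x - q), q⟫_ℝ, ?_, fun z hz => ?_, ?_⟩
  · rw [norm_smul, Real.norm_of_nonneg (by positivity)]
    exact div_mul_self_le_of_nonneg hα _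
  · rw [← sub_nonpos, ← inner_sub_right, real_inner_smul_left]
    exact mul_nonpos_of_nonneg_of_nonpos (by positivity) (hproj.inner_le_zero hX hz)
  · rw [real_inner_comm, ← inner_sub_right, real_inner_smul_left, real_inner_self_eq_norm_sq,
      hdist, dist_eq_norm]
    rcases eq_or_ne ‖x - q‖ 0 with h | h
    · simp [h]
    · field_simp

namespace Problem

theorem mem_polar_U_bound {i : Fin m} {l : Fin (k i + 1)} {ε : ℝ} (hε : 0 < ε)
    (hball : Metric.ball 0 ε ⊆ P.Z i l) {ω : Lift (dim i)}
    (hω : ∀ u ∈ P.U i l, ⟪ω, u⟫_ℝ ≤ 0) : ω.snd ≤ 0 ∧ ‖ω.fst‖ ≤ -ω.snd / ε := by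
  have hcb : Metric.closedBall 0 ε ⊆ P.Z i l := by
    rw [← closure_ball _ hε.ne']
    exact closure_minimal hball (P.Z_compact i l).isClosed
  have h1 := hω _ (P.mkLift_smul_mem_U (i := i) (l := l) (z := (ε / ‖ω.fst‖) • ω.fst) (hcb (by
    rw [mem_closedBall_zero_iff, norm_smul, Real.norm_of_nonneg (by positivity)]
    exact div_mul_self_le_of_nonneg hε.le _)) zero_le_one)
  rw [one_smul, lift_inner] at h1
  simp only [mkLift, WithLp.toLp_fst, WithLp.toLp_snd, real_inner_smul_right,
    real_inner_self_eq_norm_sq, mul_one] at h1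
  have h2 : ε / ‖ω.fst‖ * ‖ω.fst‖ ^ 2 = ε * ‖ω.fst‖ := by
    rcases eq_or_ne ‖ω.fst‖ 0 with h | h
    · simp [h]
    · field_simp
  rw [h2] at h1
  have h3 : 0 ≤ ε * ‖ω.fst‖ := by positivity
  refine ⟨by linarith, ?_⟩
  rw [le_div_iff₀ hε]
  linarith

theorem IsFeasible.exists_splitting_multipliers {xs : Vec n} (hxs : P.IsFeasible xs)
    {i : Fin m} {ε μ : ℝ} (hε : 0 < ε) (hball : Metric.ball 0 ε ⊆ P.Zcap i)
    (hbelow : -P.g i xs 0 ≤ μ) :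
    ∃ ω : Fin (k i + 1) → Lift (dim i), (∀ l, ∀ u ∈ P.U i l, ⟪ω l, u⟫_ℝ ≤ 0) ∧
      ∑ l, ω l = (P.Qt i).adjoint xs + P.qt i ∧ ∀ l, ω l ∈ OmegaSet μ ε := by
  have hballl : ∀ l, Metric.ball 0 ε ⊆ P.Z i l := fun l => hball.trans (Set.iInter_subset _ l)
  have hzero : ∀ l, (0 : Vec (dim i)) ∈ P.Z i l := fun l => hballl l (Metric.mem_ball_self hε)
  obtain ⟨ω, hω, hsum⟩ := exists_polar_decomposition (fun l => P.U i l)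
    (fun l => P.isClosed_U i l) (fun l => P.convex_U i l)
    (fun l => ⟨le_rfl, 0, hzero l, by simp⟩)
    (fun l u hu t ht => P.smul_mem_U hu ht)
    -- On each polar, ‖ω‖ is at most the sum of the two component norms, and the ball in Z^{i,l}
    -- bounds the first by 1/ε times the second.
    (-(1 + 1 / ε) • WithLp.sndL 2 ℝ (Vec (dim i)) ℝ)
    (fun l ω hω => by
      obtain ⟨h1, h2⟩ := mem_polar_U_bound hε (hballl l) hω
      change ‖ω‖ ≤ -(1 + 1 / ε) * ω.snd
      have h3 : 0 ≤ 1 / ε := by positivity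
      have h4 : 0 ≤ (1 / ε) * (-ω.snd) := mul_nonneg h3 (by linarith)
      have h5 : -ω.snd / ε = (1 / ε) * (-ω.snd) := by ring
      rw [h5] at h2
      refine abs_le_of_sq_le_sq' ?_ (by linarith) |>.2
      rw [lift_norm_sq]
      nlinarith [norm_nonneg ω.fst])
    ((P.Qt i).adjoint xs + P.qt i)
    (fun u hu => by
      obtain ⟨h0, z, hz, hzu⟩ := hu 0
      have hu' : u = mkLift (u.snd • z) u.snd := (WithLp.ext_iff ..).2 (Prod.ext hzu rfl)
      rw [inner_add_left, ContinuousLinearMap.adjoint_inner_left, hu', inner_Qt_mkLift]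
      -- For a positive last coordinate, u determines z, so the same z lies in every Z^{i,l} and
      -- f_i(x*) ≤ 0 applies.
      rcases h0.eq_or_lt with h | h
      · change u.snd * _ ≤ 0
        simp [← h]
      · refine mul_nonpos_of_nonneg_of_nonpos h0 ((g_le_f (Set.mem_iInter.2 fun l => ?_) xs).trans
          (hxs.2.2 i))
        obtain ⟨-, z', hz', hzu'⟩ := hu l
        have : z = z' := smul_right_injective _ h.ne' (hzu.symm.trans hzu')
        exact this ▸ hz')
  refine ⟨ω, hω, hsum, fun l => ?_⟩
  have hb := fun l => mem_polar_U_bound hε (hballl l) (hω l)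
  refine ⟨?_, hb l⟩
  -- Pairing with (0, 1) identifies the sum of the last coordinates. All are nonpositive, so each is
  -- at least g_i(x*, 0).
  have h1 : ∑ l, (ω l).snd = P.g i xs 0 := by
    have h2 := inner_Qt_mkLift (P := P) i xs 0 1
    rw [one_mul, ← ContinuousLinearMap.adjoint_inner_left, ← inner_add_left, ← hsum,
      sum_inner] at h2
    rw [← h2]
    refine Finset.sum_congr rfl fun l _ => ?_
    simp [mkLift]
  have h3 : ∑ l, (ω l).snd ≤ (ω l).snd := by
    rw [← Finset.add_sum_erase _ _ (Finset.mem_univ l)]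
    have : ∑ j ∈ Finset.univ.erase l, (ω j).snd ≤ 0 := Finset.sum_nonpos fun j _ => (hb j).1
    linarith
  linarith

/-- Only the first s_i - 1 vectors are variables of Ľ. The prescribed sum makes the last one the
coefficient of u_{i,s_i}, so the coupling is a sum of nonpositive pairings plus the cost and π
terms. -/
theorem coupling_le_of_polar {xs : Vec n} (hA : P.A xs = P.b)
    (ω : ∀ i, Fin (k i + 1) → Lift (dim i)) (hω : ∀ i l, ∀ u ∈ P.U i l, ⟪ω i l, u⟫_ℝ ≤ 0)
    (hsum : ∀ i, ∑ l, ω i l = (P.Qt i).adjoint xs + P.qt i) {y : Dual n r dim k}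
    (hy : ∀ i l, Dual.u y i l ∈ P.U i l) :
    P.coupling (Primal.mk xs fun i l => ω i l.castSucc) y ≤ ⟪P.c, xs⟫_ℝ + ⟪Dual.pi y, xs⟫_ℝ := by
  have h1 : ∀ i, ⟪xs, P.Qt i (Dual.uLast y i)⟫_ℝ + (⟪P.qt i, Dual.uLast y i⟫_ℝ
      + ∑ l : Fin (k i), ⟪ω i l.castSucc, Dual.u y i l.castSucc - Dual.uLast y i⟫_ℝ) ≤ 0 := by
    intro i
    have h2 := hsum i
    rw [Fin.sum_univ_castSucc] at h2
    have h3 : ⟪xs, P.Qt i (Dual.uLast y i)⟫_ℝ + ⟪P.qt i, Dual.uLast y i⟫_ℝ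
        = ∑ l : Fin (k i), ⟪ω i l.castSucc, Dual.uLast y i⟫_ℝ
          + ⟪ω i (Fin.last _), Dual.uLast y i⟫_ℝ := by
      rw [← ContinuousLinearMap.adjoint_inner_left, ← inner_add_left, ← h2, inner_add_left,
        sum_inner]
    have h4 : ∑ l : Fin (k i), ⟪ω i l.castSucc, Dual.u y i l.castSucc⟫_ℝ ≤ 0 :=
      Finset.sum_nonpos fun l _ => hω i _ _ (hy i _)
    have h5 : ⟪ω i (Fin.last _), Dual.uLast y i⟫_ℝ ≤ 0 := hω i _ _ (hy i _)
    simp only [inner_sub_right, Finset.sum_sub_distrib]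
    linarith
  have h2 := Finset.sum_nonpos fun i (_ : i ∈ Finset.univ) => h1 i
  rw [Finset.sum_add_distrib] at h2
  simp only [coupling, Primal.x_mk, Primal.om_mk, inner_add_right, inner_sum,
    ContinuousLinearMap.adjoint_inner_right, hA]
  rw [real_inner_comm xs P.c, real_inner_comm xs (Dual.pi y)]
  linarith

/-- Equal copies cancel all ω terms, and a maximising z turns g_i into f_i. -/
theorem coupling_consensus (χ : Primal n dim k) (lam : Fin m → ℝ) (z : ∀ i, Vec (dim i))
    (w : Vec r) (p : Vec n) (hz : ∀ i, P.f i (Primal.x χ) = P.g i (Primal.x χ) (z i)) :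
    P.coupling χ (Dual.mk (fun i _ => mkLift (lam i • z i) (lam i)) w p)
      = P.lagrangian (Primal.x χ) lam w + ⟪Primal.x χ, p⟫_ℝ := by
  have h1 : ∑ i, lam i * P.f i (Primal.x χ)
      = ∑ i, ⟪Primal.x χ, P.Qt i (mkLift (lam i • z i) (lam i))⟫_ℝ
        + ∑ i, ⟪P.qt i, mkLift (lam i • z i) (lam i)⟫_ℝ := by
    rw [← Finset.sum_add_distrib]
    exact Finset.sum_congr rfl fun i _ => by rw [inner_Qt_mkLift, hz]
  rw [lagrangian, h1]
  simp only [coupling, Dual.uLast, Dual.u_mk, Dual.w_mk, Dual.pi_mk, sub_self, inner_zero_right,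
    Finset.sum_const_zero, add_zero, inner_add_right, inner_sum,
    ContinuousLinearMap.adjoint_inner_right, inner_sub_right]
  rw [real_inner_comm P.c, real_inner_comm w, real_inner_comm w P.b]
  ring

theorem sqNormOf_Hop_le {τ : ℝ} (hτ : 0 < τ) (θ : Fin m → ℝ) (θw θπ : ℝ) (y : Dual n r dim k) :
    sqNormOf (P.Hop τ θ θw θπ) y ≤ ∑ i, ∑ l, (θ i)⁻¹ * ‖Dual.u y i l‖ ^ 2
      + θw⁻¹ * ‖Dual.w y‖ ^ 2 + θπ⁻¹ * ‖Dual.pi y‖ ^ 2 := by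
  have h1 := inner_Sop θ θw θπ y y
  simp only [real_inner_self_eq_norm_sq] at h1
  have h2 : sqNormOf (P.Hop τ θ θw θπ) y = ⟪Sop θ θw θπ y, y⟫_ℝ - τ * ‖P.Qbar y‖ ^ 2 := by
    rw [sqNormOf, real_inner_comm, ← real_inner_self_eq_norm_sq,
      ← ContinuousLinearMap.adjoint_inner_left, ← real_inner_smul_left, ← inner_sub_left]
    rfl
  rw [h2, h1]
  have : 0 ≤ τ * ‖P.Qbar y‖ ^ 2 := by positivity
  linarith

theorem norm_mkLift_sub_sq_le {i : Fin m} {l : Fin (k i + 1)} {z : Vec (dim i)}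
    (hz : z ∈ P.Z i l) {t M : ℝ} (ht : 0 ≤ t) (htM : t ≤ M) {u : Lift (dim i)} (hu : u ∈ P.U i l)
    (huM : u.snd ≤ M) :
    ‖mkLift (t • z) t - u‖ ^ 2 ≤ (1 + 4 * radius (P.Z i l) ^ 2) * M ^ 2 := by
  obtain ⟨hu0, z', hz', hzu⟩ := hu
  have hR := radius_nonneg (P.Z i l)
  have h1 : ‖t • z‖ ≤ M * radius (P.Z i l) := by
    rw [norm_smul, Real.norm_of_nonneg ht]
    gcongr
    · linarith
    · exact norm_le_radius (P.Z_compact i l) hz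
  have h2 : ‖u.fst‖ ≤ M * radius (P.Z i l) := by
    rw [hzu, norm_smul, Real.norm_of_nonneg hu0]
    gcongr
    · linarith
    · exact norm_le_radius (P.Z_compact i l) hz'
  have h3 : ‖t • z - u.fst‖ ^ 2 ≤ (2 * (M * radius (P.Z i l))) ^ 2 := by
    gcongr
    linarith [norm_sub_le (t • z) u.fst]
  have h4 : (t - u.snd) ^ 2 ≤ M ^ 2 := sq_le_sq' (by linarith) (by linarith)
  rw [lift_norm_sq]
  change ‖t • z - u.fst‖ ^ 2 + (t - u.snd) ^ 2 ≤ _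
  linarith

theorem norm_sub_sq_le_four_mul_max {V : Type*} [SeminormedAddCommGroup V] (a b : V) :
    ‖a - b‖ ^ 2 ≤ 4 * max ‖a‖ ‖b‖ ^ 2 := by
  have h : ‖a - b‖ ≤ 2 * max ‖a‖ ‖b‖ := by
    linarith [norm_sub_le a b, le_max_left ‖a‖ ‖b‖, le_max_right ‖a‖ ‖b‖]
  calc ‖a - b‖ ^ 2 ≤ (2 * max ‖a‖ ‖b‖) ^ 2 := by gcongr
    _ = _ := by ring

theorem IsPAPC.lagrangian_ergodic_sub_le {τ : ℝ} {θ : Fin m → ℝ} {θw θπ : ℝ} (hτ : 0 < τ)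
    (hθ : ∀ i, 0 < θ i) (hθw : 0 < θw) (hθπ : 0 < θπ) (hne : P.X.Nonempty)
    (hH : (P.Hop τ θ θw θπ).IsPositive) {ε μ : Fin m → ℝ} (hε : ∀ i, 0 < ε i)
    (hball : ∀ i, Metric.ball 0 (ε i) ⊆ P.Zcap i) {χ : ℕ → Primal n dim k}
    {y : ℕ → Dual n r dim k} (h : P.IsPAPC τ θ θw θπ χ y)
    (hom : ∀ i l, Primal.om (χ 0) i l ∈ OmegaSet (μ i) (ε i)) {xs : Vec n}
    (hxs : P.IsFeasible xs) (hbelow : ∀ i, -P.g i xs 0 ≤ μ i) {N : ℕ} (hN : 1 ≤ N) {α : ℝ}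
    (hα : 0 ≤ α) {lam : Fin m → ℝ} (hlam : ∀ i, 0 ≤ lam i) (w : Vec r) :
    P.lagrangian (Primal.x (ergodic χ N)) lam w - ⟪P.c, xs⟫_ℝ
        + α * Metric.infDist (Primal.x (ergodic χ N)) P.X
      ≤ 1 / (2 * N) * (‖xs - Primal.x (χ 0)‖ ^ 2 / τ
        + 2 * ∑ i, P.sig i / θ i * max (lam i) (lamInit (y 0) i) ^ 2
        + 4 * max ‖w‖ ‖Dual.w (y 0)‖ ^ 2 / θw
        + phiConst k τ θπ μ ε (Dual.pi (y 0)) * (1 + α ^ 2)) := by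
  obtain ⟨hmem, s, hs, hgap⟩ := h.exists_gap_bound hτ hθ hθw hθπ hne hH hN
  choose ω hω hωsum hωmem using fun i =>
    hxs.exists_splitting_multipliers (hε i) (hball i) (hbelow i)
  choose z hz hzf using fun i =>
    exists_f_eq_g (P := P) (i := i) ⟨0, hball i (Metric.mem_ball_self (hε i))⟩
      (Primal.x (ergodic χ N))
  obtain ⟨p, s', hp, hps, hpd⟩ :=
    exists_distance_certificate hne P.X_closed P.X_convex hα (Primal.x (ergodic χ N))
  have hzl : ∀ i l, z i ∈ P.Z i l := fun i l => Set.mem_iInter.1 (hz i) l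
  have h1 := hgap (Primal.mk xs fun i l => ω i l.castSucc)
    (Dual.mk (fun i _ => mkLift (lam i • z i) (lam i)) w p) s'
    (fun i l => P.mkLift_smul_mem_U (hzl i l) (hlam i)) hps
  rw [coupling_consensus _ _ _ _ _ hzf] at h1
  have h2 := coupling_le_of_polar hxs.2.1 ω hω hωsum hmem
  have h3 := hs xs hxs.1
  have hprimal : τ⁻¹ * ‖(Primal.mk xs fun i l => ω i l.castSucc) - χ 0‖ ^ 2
      ≤ ‖xs - Primal.x (χ 0)‖ ^ 2 / τ
        + 4 / τ * ∑ i, ((k i : ℝ) + 1) * μ i ^ 2 * (1 + 1 / ε i) ^ 2 := by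
    rw [Primal.norm_sq_eq, mul_add, inv_mul_eq_div, inv_mul_eq_div, div_mul_eq_mul_div]
    simp only [Primal.x_sub, Primal.x_mk, Primal.om_sub, Primal.om_mk]
    gcongr
    rw [Finset.mul_sum]
    refine Finset.sum_le_sum fun i _ => ?_
    calc ∑ l : Fin (k i), ‖ω i l.castSucc - Primal.om (χ 0) i l‖ ^ 2
        ≤ ∑ _l : Fin (k i), 4 * μ i ^ 2 * (1 + 1 / ε i) ^ 2 := Finset.sum_le_sum fun l _ =>
          norm_sub_sq_le_of_mem_OmegaSet (hε i) (hωmem i _) (hom i l)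
      _ = (k i : ℝ) * (4 * μ i ^ 2 * (1 + 1 / ε i) ^ 2) := by simp
      -- There are only s_i - 1 blocks ω_{i,l}; the constant φ counts s_i.
      _ ≤ ((k i : ℝ) + 1) * (4 * μ i ^ 2 * (1 + 1 / ε i) ^ 2) := by
          gcongr
          linarith
      _ = _ := by ring
  have hu : ∑ i, ∑ l, (θ i)⁻¹ * ‖mkLift (lam i • z i) (lam i) - Dual.u (y 0) i l‖ ^ 2
      ≤ 2 * ∑ i, P.sig i / θ i * max (lam i) (lamInit (y 0) i) ^ 2 := by
    -- The estimate already holds without the factor 2.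
    have e1 : ∑ i, ∑ l, (θ i)⁻¹ * ‖mkLift (lam i • z i) (lam i) - Dual.u (y 0) i l‖ ^ 2
        ≤ ∑ i, P.sig i / θ i * max (lam i) (lamInit (y 0) i) ^ 2 := by
      refine Finset.sum_le_sum fun i _ => ?_
      rw [← Finset.mul_sum, inv_mul_eq_div, div_mul_eq_mul_div, sig, Finset.sum_mul]
      have := hθ i
      gcongr with l
      refine norm_mkLift_sub_sq_le (hzl i l) (hlam i) (le_max_left _ _) (h.start i l) ?_
      exact (le_ciSup (f := fun l => (Dual.u (y 0) i l).snd) (Set.finite_range _).bddAbove l).trans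
        (le_max_right _ _)
    have e2 : 0 ≤ ∑ i, P.sig i / θ i * max (lam i) (lamInit (y 0) i) ^ 2 :=
      Finset.sum_nonneg fun i _ => mul_nonneg (div_nonneg (P.sig_pos i).le (hθ i).le) (sq_nonneg _)
    linarith
  have hw : θw⁻¹ * ‖w - Dual.w (y 0)‖ ^ 2 ≤ 4 * max ‖w‖ ‖Dual.w (y 0)‖ ^ 2 / θw := by
    rw [inv_mul_eq_div]
    gcongr
    exact norm_sub_sq_le_four_mul_max _ _
  have hπ : θπ⁻¹ * ‖p - Dual.pi (y 0)‖ ^ 2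
      ≤ 2 / θπ * α ^ 2 + 2 * ‖Dual.pi (y 0)‖ ^ 2 / θπ := by
    have e1 : ‖p - Dual.pi (y 0)‖ ^ 2 ≤ 2 * α ^ 2 + 2 * ‖Dual.pi (y 0)‖ ^ 2 := by
      have g1 : ‖p - Dual.pi (y 0)‖ ≤ α + ‖Dual.pi (y 0)‖ :=
        (norm_sub_le _ _).trans (by linarith)
      have g2 : ‖p - Dual.pi (y 0)‖ ^ 2 ≤ (α + ‖Dual.pi (y 0)‖) ^ 2 := by gcongr
      nlinarith [sq_nonneg (α - ‖Dual.pi (y 0)‖)]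
    calc θπ⁻¹ * ‖p - Dual.pi (y 0)‖ ^ 2
        ≤ θπ⁻¹ * (2 * α ^ 2 + 2 * ‖Dual.pi (y 0)‖ ^ 2) := by gcongr
      _ = _ := by ring
  have hdual := sqNormOf_Hop_le (P := P) hτ θ θw θπ
    (Dual.mk (fun i _ => mkLift (lam i • z i) (lam i)) w p - y 0)
  simp only [Dual.u_sub, Dual.w_sub, Dual.pi_sub, Dual.u_mk, Dual.w_mk, Dual.pi_mk] at hdual
  have hφ1 : 2 / θπ ≤ phiConst k τ θπ μ ε (Dual.pi (y 0)) := le_max_left _ _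
  have hφ2 : 4 / τ * ∑ i, ((k i : ℝ) + 1) * μ i ^ 2 * (1 + 1 / ε i) ^ 2
      + 2 * ‖Dual.pi (y 0)‖ ^ 2 / θπ ≤ phiConst k τ θπ μ ε (Dual.pi (y 0)) := le_max_right _ _
  have hφ3 := mul_le_mul_of_nonneg_right hφ1 (sq_nonneg α)
  refine le_trans (by linarith) (h1.trans ?_)
  rw [div_eq_inv_mul, ← one_div]
  exact mul_le_mul_of_nonneg_left (by linarith) (by positivity)

theorem sum_sig_mul_sq_le {θ : Fin m → ℝ} (hθ : ∀ i, 0 < θ i) {a b : Fin m → ℝ}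
    (ha : ∀ i, 0 ≤ a i) (hab : ∀ i, a i ≤ b i) (c : Fin m → ℝ) :
    ∑ i, P.sig i / θ i * max (a i) (c i) ^ 2 ≤ ∑ i, P.sig i / θ i * max (b i) (c i) ^ 2 := by
  refine Finset.sum_le_sum fun i _ => mul_le_mul_of_nonneg_left ?_
    (div_nonneg (P.sig_pos i).le (hθ i).le)
  exact pow_le_pow_left₀ (le_max_of_le_left (ha i)) (max_le_max_right _ (hab i)) 2

/-- Shifting the multipliers by the violated indices and the normalised residual adds exactly the
infeasibility measure. A zero residual is covered by 0⁻¹ = 0. -/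
theorem lagrangian_add_sign (x : Vec n) (lam : Fin m → ℝ) (w : Vec r) :
    P.lagrangian x (fun i => lam i + if 0 < P.f i x then 1 else 0)
        (w + (‖P.A x - P.b‖)⁻¹ • (P.A x - P.b))
      = P.lagrangian x lam w + ∑ i, max (P.f i x) 0 + ‖P.A x - P.b‖ := by
  have h1 : ∀ i, (lam i + if 0 < P.f i x then 1 else 0) * P.f i x
      = lam i * P.f i x + max (P.f i x) 0 := fun i => by
    split_ifs with h
    · rw [max_eq_left h.le]; ring
    · rw [max_eq_right (not_lt.1 h)]; ring
  have h2 : (‖P.A x - P.b‖)⁻¹ * ‖P.A x - P.b‖ ^ 2 = ‖P.A x - P.b‖ := by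
    rcases eq_or_ne ‖P.A x - P.b‖ 0 with h | h
    · simp [h]
    · field_simp
  simp only [lagrangian, h1, Finset.sum_add_distrib, inner_add_left, real_inner_smul_left,
    real_inner_self_eq_norm_sq, h2]
  ring

theorem lagrangian_two_mul (x : Vec n) (lam : Fin m → ℝ) (w : Vec r) :
    P.lagrangian x (fun i => 2 * lam i) ((2 : ℝ) • w)
      = 2 * P.lagrangian x lam w - ⟪P.c, x⟫_ℝ := by
  simp only [lagrangian, mul_assoc, ← Finset.mul_sum, real_inner_smul_left]
  ring

/-! ### Existence of PAPC runs and assembly of the main theorem. -/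

theorem exists_isDualUpdate (hX : P.X.Nonempty) (hZ : ∀ i, (P.Zcap i).Nonempty) (θ : Fin m → ℝ)
    (θw : ℝ) {θπ : ℝ} (hθπ : 0 < θπ) (p : Primal n dim k) (y : Dual n r dim k) :
    ∃ y', P.IsDualUpdate θ θw θπ p y y' := by
  have hU : ∀ i l, (P.U i l).Nonempty := fun i l => by
    obtain ⟨z, hz⟩ := hZ i
    exact ⟨_, P.mkLift_smul_mem_U (Set.mem_iInter.1 hz l) le_rfl⟩
  choose proj hproj using fun i l (v : Lift (dim i)) =>
    exists_isProjOn (hU i l) (P.isClosed_U i l) (P.convex_U i l) v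
  obtain ⟨q, hq⟩ := exists_isProxOf_supportFn hX P.X_closed P.X_convex hθπ
    (Dual.pi y + θπ • Primal.x p)
  refine ⟨Dual.mk (fun i => Fin.lastCases (proj i (Fin.last (k i)) (Dual.uLast y i
      + θ i • ((P.Qt i).adjoint (Primal.x p) + P.qt i - ∑ l, Primal.om p i l)))
    (fun l => proj i l.castSucc (Dual.u y i l.castSucc + θ i • Primal.om p i l)))
    (Dual.w y + θw • (P.A (Primal.x p) - P.b)) q, fun i l => ?_, fun i => ?_, rfl, hq⟩
  · rw [Dual.u_mk, Fin.lastCases_castSucc]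
    exact hproj _ _ _
  · simp only [Dual.uLast, Dual.u_mk, Fin.lastCases_last]
    exact hproj _ _ _

theorem exists_isPAPC (hX : P.X.Nonempty) (hZ : ∀ i, (P.Zcap i).Nonempty) (τ : ℝ) (θ : Fin m → ℝ)
    (θw : ℝ) {θπ : ℝ} (hθπ : 0 < θπ) (χ₀ : Primal n dim k) (y₀ : Dual n r dim k)
    (hy₀ : ∀ i l, Dual.u y₀ i l ∈ P.U i l) :
    ∃ χ y, P.IsPAPC τ θ θw θπ χ y ∧ χ 0 = χ₀ ∧ y 0 = y₀ := by
  choose D hD using exists_isDualUpdate hX hZ θ θw hθπ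
  let F : Primal n dim k × Dual n r dim k → Primal n dim k × Dual n r dim k := fun s =>
    (P.primalStep τ s.1 (D (P.primalStep τ s.1 s.2) s.2), D (P.primalStep τ s.1 s.2) s.2)
  let S : ℕ → Primal n dim k × Dual n r dim k := fun j => Nat.rec (χ₀, y₀) (fun _ s => F s) j
  exact ⟨fun j => (S j).1, fun j => (S j).2, ⟨hy₀, fun j => hD _ _, fun j => rfl⟩, rfl, rfl⟩

end Problem

end RobustPAPC

theorem mainTheorem7 {n r m : ℕ} {dim k : Fin m → ℕ} (P : Problem n r m dim k)
    -- the robust problem has an optimal solution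
    (hopt : ∃ x, P.IsOptimal x)
    -- Slater point
    (xhat : Vec n) (e : ℝ) (hslater : P.IsSlater xhat e)
    -- `A` has full row rank
    (hrank : Module.finrank ℝ (LinearMap.range P.A.toLinearMap) = r)
    -- `Z^i` contains a ball around the origin
    (ε : Fin m → ℝ) (hε : ∀ i, 0 < ε i) (hball : ∀ i, Metric.ball 0 (ε i) ⊆ P.Zcap i)
    -- the nominal constraints are bounded below on the feasible set
    (μ : Fin m → ℝ) (hμ : ∀ i, 0 < μ i)
    (hbelow : ∀ i x, P.IsFeasible x → -P.g i x 0 ≤ μ i)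
    -- strict lower bound on the optimal value
    (v : ℝ) (hv : ∀ x, P.IsOptimal x → v < inner ℝ P.c x)
    -- step sizes
    (τ : ℝ) (θ : Fin m → ℝ) (θw θπ : ℝ)
    (hτ : 0 < τ) (hθ : ∀ i, 0 < θ i) (hθw : 0 < θw) (hθπ : 0 < θπ)
    (hH : (P.Hop τ θ θw θπ).IsPositive) :
    -- ergodic primal-dual gap bound
    (∀ χ y, P.IsPAPC τ θ θw θπ χ y → ∀ N : ℕ, 1 ≤ N →
      ∀ (χ' : Primal n dim k) (y' : Dual n r dim k),
        P.saddleFn (ergodic χ N) y' - P.saddleFn χ' (ergodic y N)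
          ≤ (((τ⁻¹ * ‖χ' - χ 0‖ ^ 2 + sqNormOf (P.Hop τ θ θw θπ) (y' - y 0)) / (2 * N) : ℝ)
            : EReal)) ∧
    -- bounds for the original Lagrangian, feasibility and optimality
    (∀ χ y, P.IsPAPC τ θ θw θπ χ y → (∀ i l, Primal.om (χ 0) i l ∈ OmegaSet (μ i) (ε i)) →
      ∀ xs, P.IsOptimal xs → ∀ N : ℕ, 1 ≤ N → ∀ xbar, xbar = Primal.x (ergodic χ N) →
      ∀ β, β = P.Rpi xhat e v → ∀ φ, φ = phiConst k τ θπ μ ε (Dual.pi (y 0)) →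
        (∀ lams ws, P.IsDualOptimal lams ws →
          (∀ (α : ℝ) (lam : Fin m → ℝ) (w : Vec r), 0 ≤ α → (∀ i, 0 ≤ lam i) →
            P.lagrangian xbar lam w - P.lagrangian xs lams ws + α * Metric.infDist xbar P.X
              ≤ 1 / (2 * N) * (‖xs - Primal.x (χ 0)‖ ^ 2 / τ
                + 2 * ∑ i, P.sig i / θ i * max (lam i) (lamInit (y 0) i) ^ 2
                + 4 * max ‖w‖ ‖Dual.w (y 0)‖ ^ 2 / θw + φ * (1 + α ^ 2))) ∧
          inner ℝ P.c xs ≤ P.lagrangian xbar lams ws + β * Metric.infDist xbar P.X) ∧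
        ∑ i, max (P.f i xbar) 0 + ‖P.A xbar - P.b‖ + Metric.infDist xbar P.X
          ≤ 1 / (2 * N) * (‖xs - Primal.x (χ 0)‖ ^ 2 / τ
            + 2 * ∑ i, P.sig i / θ i * max (P.lamBar xhat v + 1) (lamInit (y 0) i) ^ 2
            + 4 * max (P.Rw xhat e v + 1) ‖Dual.w (y 0)‖ ^ 2 / θw + φ * (1 + (1 + β) ^ 2)) ∧
        |inner ℝ P.c (xbar - xs)|
          ≤ 1 / (2 * N) * (‖xs - Primal.x (χ 0)‖ ^ 2 / τ
            + 2 * ∑ i, P.sig i / θ i * max (2 * P.lamBar xhat v) (lamInit (y 0) i) ^ 2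
            + 4 * max (2 * P.Rw xhat e v) ‖Dual.w (y 0)‖ ^ 2 / θw + φ * (1 + 4 * β ^ 2))) ∧
    -- PAPC is an ergodically bounded algorithm
    ∀ pi0 : Vec n,
      IsErgodicallyBounded P (PAPCRun P τ θ θw θπ μ ε pi0) (fun N => 1 / (2 * (N : ℝ)))
        (phiConst k τ θπ μ ε pi0) τ (P.Rpi xhat e v)
        (fun i => θ i / (2 * P.sig i)) (θw / 4) := by
  have hXne : P.X.Nonempty := ⟨xhat, hslater.isFeasible.1⟩
  have hZ : ∀ i, (P.Zcap i).Nonempty := fun i => ⟨0, hball i (Metric.mem_ball_self (hε i))⟩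
  have hvopt : ∀ x, P.IsOptimal x → v ≤ ⟪P.c, x⟫_ℝ := fun x hx => (hv x hx).le
  have hvhat : v ≤ ⟪P.c, xhat⟫_ℝ := by
    obtain ⟨x, hx⟩ := hopt
    exact (hvopt x hx).trans (hx.2 xhat hslater.isFeasible)
  have hmult : ∀ xs, P.IsOptimal xs → ∃ lam w, P.IsMultiplier xs lam w := fun xs hxs =>
    hxs.exists_isMultiplier hslater hrank hZ
  have hφ0 : ∀ p : Vec n, 0 ≤ phiConst k τ θπ μ ε p := fun p =>
    le_max_of_le_left (by positivity)
  have hβ0 := Problem.Rpi_nonneg (v := v) hslater hvhat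
  refine ⟨fun χ y h N hN χ' y' => h.saddleFn_ergodic_sub_le hτ hθ hθw hθπ hXne hH hN χ' y', ?_,
    fun pi0 => ⟨hφ0 pi0, hτ, hβ0,
      fun i => div_pos (hθ i) (mul_pos two_pos (P.sig_pos i)), by positivity,
      fun N => by positivity, ?_, ?_, ?_, ?_⟩⟩
  · rintro χ y h hom xs hxs N hN xbar rfl β rfl φ rfl
    have hub := fun (α : ℝ) (lam : Fin m → ℝ) (w : Vec r) (hα : 0 ≤ α) (hlam : ∀ i, 0 ≤ lam i) =>
      h.lagrangian_ergodic_sub_le hτ hθ hθw hθπ hXne hH hε hball hom hxs.1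
        (fun i => hbelow i xs hxs.1) hN hα hlam w
    -- The multipliers are unknown, so the right-hand side is enlarged to their explicit bounds.
    have hmono : ∀ (lam : Fin m → ℝ) (w : Vec r) (Λ W a c : ℝ), (∀ i, 0 ≤ lam i) →
        (∀ i, lam i ≤ Λ) → ‖w‖ ≤ W →
        1 / (2 * (N : ℝ)) * (a + 2 * ∑ i, P.sig i / θ i * max (lam i) (lamInit (y 0) i) ^ 2
          + 4 * max ‖w‖ ‖Dual.w (y 0)‖ ^ 2 / θw + c)
        ≤ 1 / (2 * N) * (a + 2 * ∑ i, P.sig i / θ i * max Λ (lamInit (y 0) i) ^ 2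
          + 4 * max W ‖Dual.w (y 0)‖ ^ 2 / θw + c) := by
      intro lam w Λ W a c h0 hΛ hW
      have h1 := Problem.sum_sig_mul_sq_le (P := P) hθ h0 hΛ (lamInit (y 0))
      have h2 : 4 * max ‖w‖ ‖Dual.w (y 0)‖ ^ 2 / θw ≤ 4 * max W ‖Dual.w (y 0)‖ ^ 2 / θw := by
        gcongr
      exact mul_le_mul_of_nonneg_left (by linarith) (by positivity)
    refine ⟨fun lams ws hdual => ?_, ?_, ?_⟩
    · have hm := hdual.isMultiplier (hmult xs hxs)
      refine ⟨fun α lam w hα hlam => ?_,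
        hm.le_lagrangian_add hslater hrank hZ (hvopt xs hxs) hvhat _⟩
      rw [hm.lagrangian_eq hxs.1]
      exact hub α lam w hα hlam
    · obtain ⟨lam, w, hm⟩ := hmult xs hxs
      have h1 := hm.le_lagrangian_add hslater hrank hZ (hvopt xs hxs) hvhat
        (Primal.x (ergodic χ N))
      set xbar := Primal.x (ergodic χ N)
      have hlam0 : ∀ i, 0 ≤ lam i + if 0 < P.f i xbar then 1 else 0 := fun i => by
        have := hm.1 i
        split_ifs <;> linarith
      -- With α = 1 + β, the lower bound absorbs β times the distance and leaves it with coefficient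
      -- 1.
      have h2 := (hub (1 + P.Rpi xhat e v) _ (w + (‖P.A xbar - P.b‖)⁻¹ • (P.A xbar - P.b))
        (by linarith) hlam0).trans (hmono _ _ (P.lamBar xhat v + 1) (P.Rw xhat e v + 1) _ _ hlam0
        (fun i => by
          have := hm.le_lamBar hslater (hvopt xs hxs) i
          split_ifs <;> linarith)
        ((norm_add_le _ _).trans (add_le_add
          (hm.norm_le_Rw hslater hrank (hvopt xs hxs) hvhat) (by
            rw [norm_smul, norm_inv, norm_norm]
            exact inv_mul_le_one))))
      rw [Problem.lagrangian_add_sign] at h2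
      linarith
    · obtain ⟨lam, w, hm⟩ := hmult xs hxs
      have h1 := hm.le_lagrangian_add hslater hrank hZ (hvopt xs hxs) hvhat
        (Primal.x (ergodic χ N))
      have hlb := fun i => hm.le_lamBar hslater (hvopt xs hxs) i
      have hRw := hm.norm_le_Rw hslater hrank (hvopt xs hxs) hvhat
      have hl0 := Problem.lamBar_nonneg hslater hvhat
      have hR0 := Problem.Rw_nonneg hslater hvhat
      set xbar := Primal.x (ergodic χ N)
      rw [inner_sub_right]
      refine abs_le'.2 ⟨?_, ?_⟩
      · have h2 := (hub 0 0 0 le_rfl fun i => le_rfl).trans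
          (hmono 0 0 (2 * P.lamBar xhat v) (2 * P.Rw xhat e v) _ _ (fun i => le_rfl)
            (fun i => by simpa using hl0) (by simpa using hR0))
        have h3 : P.lagrangian xbar 0 0 = ⟪P.c, xbar⟫_ℝ := by simp [Problem.lagrangian]
        rw [h3, zero_mul, add_zero] at h2
        refine h2.trans (mul_le_mul_of_nonneg_left ?_ (by positivity))
        have h4 := mul_nonneg (hφ0 (Dual.pi (y 0))) (sq_nonneg (P.Rpi xhat e v))
        linarith
      -- Doubling gives L(x̄, (2λ, 2w)) = 2L(x̄, (λ, w)) - cᵀx̄, and twice the lower bound then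
      -- leaves cᵀx* - cᵀx̄ on the left.
      · have h2 := (hub (2 * P.Rpi xhat e v) (fun i => 2 * lam i) ((2 : ℝ) • w) (by linarith)
          (fun i => by linarith [hm.1 i])).trans
          (hmono _ _ (2 * P.lamBar xhat v) (2 * P.Rw xhat e v) _ _
            (fun i => by linarith [hm.1 i]) (fun i => by linarith [hlb i]) (by
              rw [norm_smul, Real.norm_ofNat]
              linarith))
        rw [Problem.lagrangian_two_mul, mul_pow] at h2
        norm_num at h2 ⊢
        linarith
  -- At N = 0 the rate is 1/0 = 0 by default, so monotonicity can only start at N = 1.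
  · intro a ha b _ hab
    have ha' : (1 : ℝ) ≤ a := Nat.one_le_cast.2 ha
    have hab' : (a : ℝ) ≤ b := Nat.cast_le.2 hab
    simp only
    gcongr
  · have h1 : Filter.Tendsto (fun N : ℕ => 2 * (N : ℝ)) Filter.atTop Filter.atTop :=
      tendsto_natCast_atTop_atTop.const_mul_atTop two_pos
    simp only [one_div]
    exact h1.inv_tendsto_atTop
  · intro x0 lam0 w0 hlam0
    obtain ⟨χ, y, h, hχ, hy⟩ := Problem.exists_isPAPC hXne hZ τ θ θw hθπ
      (Primal.mk x0 fun i l => 0)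
      (Dual.mk (fun i l => mkLift (lam0 i • (0 : Vec (dim i))) (lam0 i)) w0 pi0) fun i l =>
        P.mkLift_smul_mem_U (Set.mem_iInter.1 (hball i (Metric.mem_ball_self (hε i))) l) (hlam0 i)
    refine ⟨fun j => Primal.x (χ j), fun j i => (Dual.uLast (y j) i).snd, fun j => Dual.w (y j),
      ⟨χ, y, h, ?_, fun i l => ?_, fun i l => ?_, fun _ => rfl, fun _ _ => rfl, fun _ => rfl⟩,
      ?_, ?_, ?_⟩
    · rw [hy]; rfl
    · rw [hχ]
      refine ⟨?_, le_rfl, ?_⟩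
      · change -μ i ≤ 0
        linarith [hμ i]
      · simp
    · rw [hy]; rfl
    · simp only [hχ]; rfl
    · simp only [hy]; rfl
    · simp only [hy]; rfl
  · rintro x lam w ⟨χ, y, h, rfl, hom, hlam, hx, hl, hw⟩ xs lams ws hsad N hN
    obtain ⟨hxs, hm⟩ := hsad.isOptimal_and_isMultiplier
    have hxe : ergodic x N = Primal.x (ergodic χ N) := by
      rw [Primal.x_ergodic, ← funext hx]
    have hl0 : ∀ i, lam 0 i = lamInit (y 0) i := fun i => by
      rw [hl, lamInit]
      simp only [hlam, ciSup_const]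
    rw [hxe, hm.lagrangian_eq hxs.1]
    refine ⟨fun α lam' w' hα hlam' => ?_, ?_⟩
    · refine (h.lagrangian_ergodic_sub_le hτ hθ hθw hθπ hXne hH hε hball hom hxs.1
        (fun i => hbelow i xs hxs.1) hN hα hlam' w').trans (le_of_eq ?_)
      have e1 : ∑ i, (θ i / (2 * P.sig i))⁻¹ * max (lam' i) (lam 0 i) ^ 2
          = 2 * ∑ i, P.sig i / θ i * max (lam' i) (lamInit (y 0) i) ^ 2 := by
        rw [Finset.mul_sum]
        refine Finset.sum_congr rfl fun i _ => ?_
        rw [hl0, inv_div]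
        ring
      rw [e1, hx, hw, inv_div]
      ring
    · have := hm.le_lagrangian_add hslater hrank hZ (hvopt xs hxs) hvhat
        (Primal.x (ergodic χ N))
      linarith
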